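/- Let $k\in(0,1)$ and let $u_{cn}(x,t)=k\,\mathrm{cn}(x-ct;k)$ with $c=2k^2-1$, a smooth solution of the mKdV equation $u_t+6u^2u_x+u_{xxx}=0$. Put $\kappa=k\sqrt{1-k^2}$, $\lambda_I=\tfrac12\bigl(k+i\sqrt{1-k^2}\bigr)$ and $$\theta(x,t)=-4\lambda_I\bigl(u_{cn}(x,t)^2+i\kappa\bigr)\left[\int_0^{x-ct}\frac{k^2\mathrm{cn}(y;k)^2}{(k^2\mathrm{cn}(y;k)^2+i\kappa)^2}\,dy-t\right].$$ The Lax pair of mKdV with potential $u$ and spectral parameter $\lambda$ is $\varphi_x=U\varphi$, $\varphi_t=V\varphi$ for $\varphi=(\varphi_1,\varphi_2)^t$, with $$U=\begin{pmatrix}\lambda&u\\-u&-\lambda\end{pmatrix},\qquad V=\begin{pmatrix}-4\lambda^3-2\lambda u^2&-4\lambda^2u-2\lambda u_x-2u^3-u_{xx}\\4\lambda^2u-2\lambda u_x+2u^3+u_{xx}&4\lambda^3+2\lambda u^2\end{pmatrix}.$$ 1. For $u=u_{cn}$, $\lambda=\lambda_I$ there is a solution $\varphi=(\varphi_1,\varphi_2)^t$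 of the Lax pair on $\mathbb R^2$ with $\varphi_1^2+\varphi_2^2=u$, $\varphi_1^2-\varphi_2^2=u_x/(2\lambda_I)$, $4\lambda_I\varphi_1\varphi_2=-i\kappa-u^2$. For every such $\varphi$, the functions $\varphi_1,\varphi_2$ have no zeros and are periodic in $x$ with a common period; the vector $\psi=(\psi_1,\psi_2)^t$ with $\psi_1=(\theta-1)/\varphi_2$, $\psi_2=(\theta+1)/\varphi_1$ also solves the Lax pair with $\lambda=\lambda_I$, $u=u_{cn}$, satisfies $\varphi_1\psi_2-\varphi_2\psi_1=2$, and neither $\psi_1$ nor $\psi_2$ is periodic in $x$; and $\bar\psi$ solves the Lax pair with $\lambda=\bar\lambda_I$, $u=u_{cn}$. 2. The two-fold Darboux transformation $$\tilde u=u+\frac{4(\lambda_1^2-\lambda_2^2)\left[\lambda_1p_1q_1(p_2^2+q_2^2)-\lambda_2p_2q_2(p_1^2+q_1^2)\right]}{(\lambda_1^2+\lambda_2^2)(p_1^2+q_1^2)(p_2^2+q_2^2)-2\lambda_1\lambda_2\left[4p_1q_1p_2q_2+(p_1^2-q_1^2)(p_2^2-q_2^2)\right]}$$ applied to $u=u_{cn}$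 with $(p_1,q_1)=(\psi_1,\psi_2)$, $\lambda_1=\lambda_I$, $(p_2,q_2)=(\bar\psi_1,\bar\psi_2)$, $\lambda_2=\bar\lambda_I$ has nowhere vanishing denominator and gives the real function $u_{cn\text{-}rogue}=u_{cn}+G_1/G_2$, where, with $u=u_{cn}$, $u'=\partial_xu_{cn}$, $$G_1=4\kappa\,\mathrm{Im}\left[(u^2+i\kappa)(1-\theta^2)\left((1+\bar\theta^2)u-\bar\lambda_I^{-1}\bar\theta u'\right)\right],$$ $$G_2=(1-2k^2)\left|(1+\theta^2)u-\lambda_I^{-1}\theta u'\right|^2+|1-\theta^2|^2\left[u^4+k^2(1-k^2)\right]+\left|(1+\theta^2)(2\lambda_I)^{-1}u'-2\theta u\right|^2,$$ and $G_2\ne0$ on $\mathbb R^2$. The function $u_{cn\text{-}rogue}$ is a smooth solution of the mKdV equation on $\mathbb R^2$. 3. $u_{cn\text{-}rogue}(x,t)+u_{cn}(x,t)\to0$ as $|x|+|t|\to\infty$. 4. $u_{cn\text{-}rogue}$, as a function on the $(x,t)$-plane, has a local maximum at $(0,0)$, with $\partial_x^2u_{cn\text{-}rogue}(0,0)<0$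 and $u_{cn\text{-}rogue}(0,0)=3k$. Moreover, $\max_{x\in[-2K(k),2K(k)]}|u_{cn}(x,0)|=k$, where $K(k)$ is the complete elliptic integral of the first kind, so the magnification factor is $$M_{cn}(k)=\frac{u_{cn\text{-}rogue}(0,0)}{\max_{x\in[-2K(k),2K(k)]}|u_{cn}(x,0)|}=3\quad\text{for every }k\in(0,1).$$ -/

import Mathlib

open scoped ContDiff

noncomputable section

/-! ### Jacobian elliptic functions with modulus `k` -/

namespace Jacobi

/-- The incomplete elliptic integral of the first kind
`F(φ; k) = ∫₀^φ ds / √(1 - k² sin² s)`. -/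
def ellipticF (k φ : ℝ) : ℝ :=
  ∫ s in (0 : ℝ)..φ, 1 / Real.sqrt (1 - k ^ 2 * Real.sin s ^ 2)

/-- The complete elliptic integral `K(k) = F(π/2; k)`. -/
def ellipticK (k : ℝ) : ℝ := ellipticF k (Real.pi / 2)

/-- The Jacobi amplitude: the inverse function of `φ ↦ F(φ; k)`, which is a bijection of `ℝ`
for `0 ≤ k < 1` (see `ellipticF_bijective`). -/
def am (k x : ℝ) : ℝ := Function.invFun (ellipticF k) x

/-- `cn(x; k) = cos (am(x; k))`. -/
def cn (k x : ℝ) : ℝ := Real.cos (am k x)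

lemma radicand_pos {k : ℝ} (hk0 : 0 ≤ k) (hk1 : k < 1) (s : ℝ) :
    0 < 1 - k ^ 2 * Real.sin s ^ 2 := by
  have h1 : Real.sin s ^ 2 ≤ 1 := Real.sin_sq_le_one s
  have h2 : 0 ≤ Real.sin s ^ 2 := sq_nonneg _
  nlinarith

lemma integrand_continuous {k : ℝ} (hk0 : 0 ≤ k) (hk1 : k < 1) :
    Continuous (fun s : ℝ => 1 / Real.sqrt (1 - k ^ 2 * Real.sin s ^ 2)) := by
  refine Continuous.div continuous_const (by fun_prop) ?_
  intro s
  exact (Real.sqrt_pos.mpr (radicand_pos hk0 hk1 s)).ne'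

lemma one_le_integrand {k : ℝ} (hk0 : 0 ≤ k) (hk1 : k < 1) (s : ℝ) :
    1 ≤ 1 / Real.sqrt (1 - k ^ 2 * Real.sin s ^ 2) := by
  rw [le_div_iff₀ (Real.sqrt_pos.mpr (radicand_pos hk0 hk1 s)), one_mul]
  refine (Real.sqrt_le_sqrt (?_ : _ ≤ (1 : ℝ))).trans_eq Real.sqrt_one
  nlinarith [mul_nonneg (sq_nonneg k) (sq_nonneg (Real.sin s))]

lemma sub_le_ellipticF_sub {k : ℝ} (hk0 : 0 ≤ k) (hk1 : k < 1) {a b : ℝ} (hab : a ≤ b) :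
    b - a ≤ ellipticF k b - ellipticF k a := by
  have hi : ∀ c d : ℝ, IntervalIntegrable
      (fun s : ℝ => 1 / Real.sqrt (1 - k ^ 2 * Real.sin s ^ 2)) MeasureTheory.volume c d :=
    fun c d => (integrand_continuous hk0 hk1).intervalIntegrable c d
  unfold ellipticF
  rw [intervalIntegral.integral_interval_sub_left (hi 0 b) (hi 0 a)]
  have h := intervalIntegral.integral_mono_on hab
    (intervalIntegrable_const (c := (1 : ℝ))) (hi a b) (fun s _ => one_le_integrand hk0 hk1 s)
  simpa using h

/-- For `0 ≤ k < 1` the map `F(·; k)` is a bijection of `ℝ`, so that `am` is its inverse. -/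
lemma ellipticF_bijective {k : ℝ} (hk0 : 0 ≤ k) (hk1 : k < 1) :
    Function.Bijective (ellipticF k) := by
  have hz : ellipticF k 0 = 0 := by simp [ellipticF]
  have hmono : StrictMono (ellipticF k) := by
    intro a b hab
    have := sub_le_ellipticF_sub hk0 hk1 hab.le
    linarith
  refine ⟨hmono.injective, ?_⟩
  have hcont : Continuous (ellipticF k) :=
    intervalIntegral.continuous_primitive
      (fun a b => (integrand_continuous hk0 hk1).intervalIntegrable a b) 0
  refine hcont.surjective ?_ ?_
  · refine Filter.tendsto_atTop_mono' _ ?_ Filter.tendsto_id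
    filter_upwards [Filter.eventually_ge_atTop (0 : ℝ)] with b hb
    have := sub_le_ellipticF_sub hk0 hk1 hb
    simp only [id_eq]
    linarith
  · refine Filter.tendsto_atBot_mono' _ ?_ Filter.tendsto_id
    filter_upwards [Filter.eventually_le_atBot (0 : ℝ)] with b hb
    have := sub_le_ellipticF_sub hk0 hk1 hb
    simp only [id_eq]
    linarith

end Jacobi

namespace MKdV

/-! ### The mKdV equation, its Lax pair and the two-fold Darboux transformation -/

/-- `u = u(x,t)` is a smooth real solution on the plane of `u_t + 6 u² u_x + u_xxx = 0`. -/
def IsSolution (u : ℝ → ℝ → ℝ) : Prop :=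
  ContDiff ℝ ∞ (Function.uncurry u) ∧
    ∀ x t : ℝ, deriv (fun s => u x s) t + 6 * u x t ^ 2 * deriv (fun y => u y t) x
      + iteratedDeriv 3 (fun y => u y t) x = 0

/-- `(p, q)` solves the Lax pair `φ_x = U(lam,u) φ`, `φ_t = V(lam,u) φ` of the mKdV equation with
spectral parameter `lam` and real potential `u`, on the whole plane. -/
def IsLaxSolution (lam : ℂ) (u : ℝ → ℝ → ℝ) (p q : ℝ → ℝ → ℂ) : Prop :=
  ∀ x t : ℝ,
    let v : ℂ := (u x t : ℂ)
    let vx : ℂ := ((deriv (fun y => u y t) x : ℝ) : ℂ)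
    let vxx : ℂ := ((iteratedDeriv 2 (fun y => u y t) x : ℝ) : ℂ)
    HasDerivAt (fun y => p y t) (lam * p x t + v * q x t) x ∧
    HasDerivAt (fun y => q y t) (-v * p x t - lam * q x t) x ∧
    HasDerivAt (fun s => p x s)
      ((-4 * lam ^ 3 - 2 * lam * v ^ 2) * p x t
        + (-4 * lam ^ 2 * v - 2 * lam * vx - 2 * v ^ 3 - vxx) * q x t) t ∧
    HasDerivAt (fun s => q x s)
      ((4 * lam ^ 2 * v - 2 * lam * vx + 2 * v ^ 3 + vxx) * p x t
        + (4 * lam ^ 3 + 2 * lam * v ^ 2) * q x t) t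

/-- The denominator in the two-fold Darboux transformation. -/
def twoFoldDenom (lam₁ lam₂ p₁ q₁ p₂ q₂ : ℂ) : ℂ :=
  (lam₁ ^ 2 + lam₂ ^ 2) * (p₁ ^ 2 + q₁ ^ 2) * (p₂ ^ 2 + q₂ ^ 2)
    - 2 * lam₁ * lam₂ * (4 * p₁ * q₁ * p₂ * q₂ + (p₁ ^ 2 - q₁ ^ 2) * (p₂ ^ 2 - q₂ ^ 2))

/-- The two-fold Darboux transformation of the potential value `u` by the vectors `(p₁,q₁)` and
`(p₂,q₂)` with spectral parameters `lam₁` and `lam₂`. -/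
def twoFoldDarboux (u lam₁ lam₂ p₁ q₁ p₂ q₂ : ℂ) : ℂ :=
  u + 4 * (lam₁ ^ 2 - lam₂ ^ 2)
      * (lam₁ * p₁ * q₁ * (p₂ ^ 2 + q₂ ^ 2) - lam₂ * p₂ * q₂ * (p₁ ^ 2 + q₁ ^ 2))
      / twoFoldDenom lam₁ lam₂ p₁ q₁ p₂ q₂

/-! ### The cn-periodic wave and its eigenfunctions -/

/-- The profile `ξ ↦ k cn(ξ; k)`. -/
def cnProfile (k ξ : ℝ) : ℝ := k * Jacobi.cn k ξ

/-- The wave speed `c = 2k² - 1`. -/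
def cnSpeed (k : ℝ) : ℝ := 2 * k ^ 2 - 1

/-- The cn-periodic wave `u_cn(x,t) = k cn(x - ct; k)`. -/
def uCn (k x t : ℝ) : ℝ := cnProfile k (x - cnSpeed k * t)

/-- `∂ₓ u_cn`. -/
def uCnX (k x t : ℝ) : ℝ := deriv (fun y => uCn k y t) x

/-- The number `k √(1 - k²)`. -/
def kap (k : ℝ) : ℝ := k * Real.sqrt (1 - k ^ 2)

/-- The eigenvalue `λ_I = (k + i √(1 - k²)) / 2`. -/
def lamI (k : ℝ) : ℂ := ((k : ℂ) + Complex.I * (Real.sqrt (1 - k ^ 2) : ℂ)) / 2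

/-- `φ = (φ₁, φ₂)` is the (periodic) eigenfunction at `λ_I`: it solves the Lax pair with
potential `u_cn`, and is normalized by `φ₁² + φ₂² = u`, `φ₁² - φ₂² = u_x / (2 λ_I)`,
`4 λ_I φ₁ φ₂ = E₀ - u²` with `E₀ = -i k √(1 - k²)`. -/
def IsCnEigenfunction (k : ℝ) (φ₁ φ₂ : ℝ → ℝ → ℂ) : Prop :=
  IsLaxSolution (lamI k) (uCn k) φ₁ φ₂ ∧
    ∀ x t : ℝ,
      φ₁ x t ^ 2 + φ₂ x t ^ 2 = (uCn k x t : ℂ) ∧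
      φ₁ x t ^ 2 - φ₂ x t ^ 2 = (uCnX k x t : ℂ) / (2 * lamI k) ∧
      4 * lamI k * φ₁ x t * φ₂ x t = -Complex.I * (kap k : ℂ) - (uCn k x t : ℂ) ^ 2

/-- The function `θ_cn(x,t)`, with `u = u_cn` and `κ = k √(1 - k²)`:
`-4 λ_I (u(x,t)² + iκ) [∫₀^{x-ct} (k cn y)² / ((k cn y)² + iκ)² dy - t]`. -/
def thetaCn (k x t : ℝ) : ℂ :=
  -4 * lamI k * ((uCn k x t : ℂ) ^ 2 + Complex.I * (kap k : ℂ)) *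
    ((∫ y in (0 : ℝ)..(x - cnSpeed k * t),
        (cnProfile k y : ℂ) ^ 2 / ((cnProfile k y : ℂ) ^ 2 + Complex.I * (kap k : ℂ)) ^ 2)
      - (t : ℂ))

/-- First component `ψ₁ = (θ_cn - 1) / φ₂` of the non-periodic eigenfunction. -/
def psi₁ (k : ℝ) (φ₂ : ℝ → ℝ → ℂ) (x t : ℝ) : ℂ := (thetaCn k x t - 1) / φ₂ x t

/-- Second component `ψ₂ = (θ_cn + 1) / φ₁` of the non-periodic eigenfunction. -/
def psi₂ (k : ℝ) (φ₁ : ℝ → ℝ → ℂ) (x t : ℝ) : ℂ := (thetaCn k x t + 1) / φ₁ x t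

/-! ### The rogue cn-periodic wave -/

/-- The numerator `G₁`. -/
def G₁ (k x t : ℝ) : ℝ :=
  let u : ℂ := (uCn k x t : ℂ)
  let ux : ℂ := (uCnX k x t : ℂ)
  let θ : ℂ := thetaCn k x t
  4 * kap k *
    ((u ^ 2 + Complex.I * (kap k : ℂ)) * (1 - θ ^ 2) *
      ((1 + starRingEnd ℂ θ ^ 2) * u
        - (starRingEnd ℂ (lamI k))⁻¹ * starRingEnd ℂ θ * ux)).im

/-- The denominator `G₂`. -/
def G₂ (k x t : ℝ) : ℝ :=
  let u : ℂ := (uCn k x t : ℂ)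
  let ux : ℂ := (uCnX k x t : ℂ)
  let θ : ℂ := thetaCn k x t
  (1 - 2 * k ^ 2) * ‖(1 + θ ^ 2) * u - (lamI k)⁻¹ * θ * ux‖ ^ 2
    + ‖1 - θ ^ 2‖ ^ 2 * (uCn k x t ^ 4 + k ^ 2 * (1 - k ^ 2))
    + ‖(1 + θ ^ 2) * (2 * lamI k)⁻¹ * ux - 2 * θ * u‖ ^ 2

/-- The rogue cn-periodic wave `u_cn-rogue = u_cn + G₁ / G₂`. -/
def uCnRogue (k x t : ℝ) : ℝ := uCn k x t + G₁ k x t / G₂ k x t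

/-- The values `|u_cn(x,0)|` over one period `x ∈ [-2K(k), 2K(k)]`. -/
def cnAmplitudes (k : ℝ) : Set ℝ :=
  (fun x => |uCn k x 0|) '' Set.Icc (-2 * Jacobi.ellipticK k) (2 * Jacobi.ellipticK k)

/-- The magnification factor
`M_cn(k) = u_cn-rogue(0,0) / max_{x ∈ [-2K(k), 2K(k)]} |u_cn(x,0)|`. -/
def magnificationCn (k : ℝ) : ℝ := uCnRogue k 0 0 / sSup (cnAmplitudes k)

end MKdV

end

/-! The profile `U = k cn` satisfies `U'' = cU - 2U³` and `U'² = (k² - U²)(1 - k² + U²)`. With `W =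
u² + iκ` the first integral becomes `(2λ_I u)² - u_x² = W²`, which is the compatibility of the
prescribed values of `φ₁²`, `φ₂²` and `φ₁φ₂`. As `W` never vanishes, `φ₁` is a global smooth square
root and `φ₂` is the product divided by `φ₁`. The Lax matrices are traceless, so a second solution
with Wronskian 2 has the form `ψ₁ = (θ - 1)/φ₂`, `ψ₂ = (θ + 1)/φ₁`, with first-order linear
equations for `θ`.

The two-fold Darboux transformation is a composition of two one-fold ones, performed over complex
potentials on the open set where `ψ₁² + ψ₂² ≠ 0` (`exists_isSolOn_twoFoldDarboux`). Its denominator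
is a nonzero multiple of `G₂`, and `G₂ > 0` by a triangle inequality (`G₂_pos`), so the final
formula is smooth also where the intermediate potential is singular. Those singularities are
isolated in `x` since `ψ ≠ 0`, and continuity carries the mKdV equation across them
(`isSolution_uCnRogue`).

The imaginary part of the integral in `θ` has an integrand of one sign with nonzero mean, and the
real number `t` cannot compensate it; hence `|θ| → ∞` (`tendsto_norm_thetaCn`). This gives the
non-periodicity of `ψ`, and the limit: `G₁/G₂` tends to `-2u` as `1/θ → 0`, uniformly over the
compact curve of values `(u, u_x)`.

At the origin the decisive estimate is `u_rogue ≤ 3k - c(k - u)` near `(0,0)` with `c > 0`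
(`exists_eventually_uCnRogue_le`). It yields the local maximum, and comparison with `u_xx(0,0) = -k`
yields the strict sign of the second derivative. -/

noncomputable section

/-! ### Jacobi elliptic functions: derivatives, smoothness, a real period. -/

namespace Jacobi

/-- `sn(x; k) = sin (am(x; k))`. -/
def sn (k x : ℝ) : ℝ := Real.sin (am k x)

/-- `dn(x; k) = √(1 - k² sn²(x; k))`. -/
def dn (k x : ℝ) : ℝ := Real.sqrt (1 - k ^ 2 * Real.sin (am k x) ^ 2)

variable {k : ℝ}

lemma ellipticF_strictMono (hk0 : 0 ≤ k) (hk1 : k < 1) : StrictMono (ellipticF k) := by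
  intro a b hab
  have := sub_le_ellipticF_sub hk0 hk1 hab.le
  linarith

lemma ellipticF_zero (k : ℝ) : ellipticF k 0 = 0 := by simp [ellipticF]

lemma ellipticF_am (hk0 : 0 ≤ k) (hk1 : k < 1) (x : ℝ) : ellipticF k (am k x) = x :=
  Function.rightInverse_invFun (ellipticF_bijective hk0 hk1).surjective x

lemma am_ellipticF (hk0 : 0 ≤ k) (hk1 : k < 1) (φ : ℝ) : am k (ellipticF k φ) = φ :=
  Function.leftInverse_invFun (ellipticF_bijective hk0 hk1).injective φ

lemma am_zero (hk0 : 0 ≤ k) (hk1 : k < 1) : am k 0 = 0 := by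
  have := am_ellipticF hk0 hk1 0
  rwa [ellipticF_zero] at this

lemma hasDerivAt_ellipticF (hk0 : 0 ≤ k) (hk1 : k < 1) (φ : ℝ) :
    HasDerivAt (ellipticF k) (1 / Real.sqrt (1 - k ^ 2 * Real.sin φ ^ 2)) φ :=
  ((integrand_continuous hk0 hk1).integral_hasStrictDerivAt 0 φ).hasDerivAt

lemma continuous_am (hk0 : 0 ≤ k) (hk1 : k < 1) : Continuous (am k) := by
  have hmono : Monotone (am k) := by
    intro x y hxy
    by_contra! h
    have := ellipticF_strictMono hk0 hk1 h
    rw [ellipticF_am hk0 hk1, ellipticF_am hk0 hk1] at this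
    linarith
  exact hmono.continuous_of_surjective fun φ => ⟨_, am_ellipticF hk0 hk1 φ⟩

lemma hasDerivAt_am (hk0 : 0 ≤ k) (hk1 : k < 1) (x : ℝ) : HasDerivAt (am k) (dn k x) x := by
  have hpos := Real.sqrt_pos.mpr (radicand_pos hk0 hk1 (am k x))
  have h := HasDerivAt.of_local_left_inverse (continuous_am hk0 hk1).continuousAt
    (hasDerivAt_ellipticF hk0 hk1 (am k x)) (by positivity)
    (Filter.Eventually.of_forall (ellipticF_am hk0 hk1))
  simpa [dn] using h

/-- Bootstrap: `am' = √(1 - k² sin² am)` with radicand bounded away from the singularity of the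
root, so each order of smoothness of `am` gives the next. -/
lemma contDiff_am (hk0 : 0 ≤ k) (hk1 : k < 1) : ContDiff ℝ ∞ (am k) := by
  rw [contDiff_infty]
  intro n
  induction n with
  | zero => exact contDiff_zero.mpr (continuous_am hk0 hk1)
  | succ n ih =>
    rw [Nat.cast_succ]
    refine contDiff_succ_iff_deriv.mpr
      ⟨fun x => (hasDerivAt_am hk0 hk1 x).differentiableAt, by simp, ?_⟩
    have h : deriv (am k) = fun x => Real.sqrt (1 - k ^ 2 * Real.sin (am k x) ^ 2) :=
      funext fun x => (hasDerivAt_am hk0 hk1 x).deriv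
    rw [h]
    exact (contDiff_const.sub (contDiff_const.mul (ih.sin.pow 2))).sqrt
      fun x => (radicand_pos hk0 hk1 _).ne'

lemma ellipticF_add_two_pi (hk0 : 0 ≤ k) (hk1 : k < 1) (φ : ℝ) :
    ellipticF k (φ + 2 * Real.pi) = ellipticF k φ + ellipticF k (2 * Real.pi) := by
  have hi : ∀ c d : ℝ, IntervalIntegrable
      (fun s : ℝ => 1 / Real.sqrt (1 - k ^ 2 * Real.sin s ^ 2)) MeasureTheory.volume c d :=
    fun c d => (integrand_continuous hk0 hk1).intervalIntegrable c d
  have hper : Function.Periodic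
      (fun s : ℝ => 1 / Real.sqrt (1 - k ^ 2 * Real.sin s ^ 2)) (2 * Real.pi) := by
    intro s; simp
  have h := hper.intervalIntegral_add_eq φ 0
  rw [zero_add] at h
  unfold ellipticF
  rw [← h, intervalIntegral.integral_add_adjacent_intervals (hi _ _) (hi _ _)]

/-- A (real) period of the Jacobi elliptic functions. -/
def period (k : ℝ) : ℝ := ellipticF k (2 * Real.pi)

lemma period_pos (hk0 : 0 ≤ k) (hk1 : k < 1) : 0 < period k := by
  have := ellipticF_strictMono hk0 hk1 Real.two_pi_pos
  rwa [ellipticF_zero] at this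

lemma am_add_period (hk0 : 0 ≤ k) (hk1 : k < 1) (x : ℝ) :
    am k (x + period k) = am k x + 2 * Real.pi := by
  have := ellipticF_add_two_pi hk0 hk1 (am k x)
  rw [ellipticF_am hk0 hk1] at this
  rw [period, ← this, am_ellipticF hk0 hk1]

lemma hasDerivAt_cn (hk0 : 0 ≤ k) (hk1 : k < 1) (x : ℝ) :
    HasDerivAt (cn k) (-sn k x * dn k x) x :=
  (hasDerivAt_am hk0 hk1 x).cos

lemma hasDerivAt_sn (hk0 : 0 ≤ k) (hk1 : k < 1) (x : ℝ) :
    HasDerivAt (sn k) (cn k x * dn k x) x :=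
  (hasDerivAt_am hk0 hk1 x).sin

lemma dn_pos (hk0 : 0 ≤ k) (hk1 : k < 1) (x : ℝ) : 0 < dn k x :=
  Real.sqrt_pos.mpr (radicand_pos hk0 hk1 _)

lemma dn_sq (hk0 : 0 ≤ k) (hk1 : k < 1) (x : ℝ) : dn k x ^ 2 = 1 - k ^ 2 * sn k x ^ 2 :=
  Real.sq_sqrt (radicand_pos hk0 hk1 _).le

lemma hasDerivAt_dn (hk0 : 0 ≤ k) (hk1 : k < 1) (x : ℝ) :
    HasDerivAt (dn k) (-k ^ 2 * sn k x * cn k x) x := by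
  have h := (((hasDerivAt_sn hk0 hk1 x).pow 2).const_mul (k ^ 2)).const_sub 1
  have h2 := h.sqrt (radicand_pos hk0 hk1 _).ne'
  have hd := dn_pos hk0 hk1 x
  refine h2.congr_deriv ?_
  change _ / (2 * dn k x) = _
  field_simp
  push_cast
  ring

end Jacobi

/-! ### The cn profile, its differential equations, and the background wave. -/

namespace MKdV

variable {k : ℝ}

/-- The derivative of the cn-profile. -/
def cnProfileDeriv (k ξ : ℝ) : ℝ := -k * Jacobi.sn k ξ * Jacobi.dn k ξ

lemma hasDerivAt_cnProfile (hk0 : 0 ≤ k) (hk1 : k < 1) (ξ : ℝ) :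
    HasDerivAt (cnProfile k) (cnProfileDeriv k ξ) ξ := by
  refine ((Jacobi.hasDerivAt_cn hk0 hk1 ξ).const_mul k).congr_deriv ?_
  rw [cnProfileDeriv]; ring

/-- The travelling-wave reduction of mKdV, integrated once. Through it all `x`-derivatives of `uCn`
become polynomials in `u` and `u_x`. -/
lemma hasDerivAt_cnProfileDeriv (hk0 : 0 ≤ k) (hk1 : k < 1) (ξ : ℝ) :
    HasDerivAt (cnProfileDeriv k) (cnSpeed k * cnProfile k ξ - 2 * cnProfile k ξ ^ 3) ξ := by
  refine (((Jacobi.hasDerivAt_sn hk0 hk1 ξ).const_mul (-k)).mul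
    (Jacobi.hasDerivAt_dn hk0 hk1 ξ)).congr_deriv ?_
  have h1 := Jacobi.dn_sq hk0 hk1 ξ
  have h2 : Jacobi.sn k ξ ^ 2 + Jacobi.cn k ξ ^ 2 = 1 := Real.sin_sq_add_cos_sq _
  rw [cnProfile, cnSpeed]
  linear_combination -k * Jacobi.cn k ξ * h1 + 2 * k ^ 3 * Jacobi.cn k ξ * h2

/-- The energy integral. It confines `(u, u_x)` to a compact algebraic curve, which the
eigenfunctions, the limit at infinity and the local maximum all rely on. -/
lemma cnProfileDeriv_sq (hk0 : 0 ≤ k) (hk1 : k < 1) (ξ : ℝ) :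
    cnProfileDeriv k ξ ^ 2 = (k ^ 2 - cnProfile k ξ ^ 2) * (1 - k ^ 2 + cnProfile k ξ ^ 2) := by
  have h1 := Jacobi.dn_sq hk0 hk1 ξ
  have h2 : Jacobi.sn k ξ ^ 2 + Jacobi.cn k ξ ^ 2 = 1 := Real.sin_sq_add_cos_sq _
  have h3 : Jacobi.sn k ξ ^ 2 = 1 - Jacobi.cn k ξ ^ 2 := by linarith
  rw [cnProfile, cnProfileDeriv, mul_pow, mul_pow, h1, h3]
  ring

lemma abs_cnProfile_le (hk0 : 0 ≤ k) (ξ : ℝ) : |cnProfile k ξ| ≤ k := by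
  rw [cnProfile, abs_mul, abs_of_nonneg hk0]
  exact mul_le_of_le_one_right hk0 (Real.abs_cos_le_one _)

lemma cnProfile_zero (hk0 : 0 ≤ k) (hk1 : k < 1) : cnProfile k 0 = k := by
  simp [cnProfile, Jacobi.cn, Jacobi.am_zero hk0 hk1]

lemma cnProfileDeriv_zero (hk0 : 0 ≤ k) (hk1 : k < 1) : cnProfileDeriv k 0 = 0 := by
  simp [cnProfileDeriv, Jacobi.sn, Jacobi.am_zero hk0 hk1]

lemma periodic_cnProfile (hk0 : 0 ≤ k) (hk1 : k < 1) :
    Function.Periodic (cnProfile k) (Jacobi.period k) := by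
  intro ξ
  simp [cnProfile, Jacobi.cn, Jacobi.am_add_period hk0 hk1]

lemma periodic_cnProfileDeriv (hk0 : 0 ≤ k) (hk1 : k < 1) :
    Function.Periodic (cnProfileDeriv k) (Jacobi.period k) := by
  intro ξ
  simp [cnProfileDeriv, Jacobi.sn, Jacobi.dn, Jacobi.am_add_period hk0 hk1]

lemma contDiff_cnProfile (hk0 : 0 ≤ k) (hk1 : k < 1) : ContDiff ℝ ∞ (cnProfile k) :=
  contDiff_const.mul (Jacobi.contDiff_am hk0 hk1).cos

lemma contDiff_cnProfileDeriv (hk0 : 0 ≤ k) (hk1 : k < 1) : ContDiff ℝ ∞ (cnProfileDeriv k) :=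
  (contDiff_const.mul (Jacobi.contDiff_am hk0 hk1).sin).mul
    ((contDiff_const.sub (contDiff_const.mul ((Jacobi.contDiff_am hk0 hk1).sin.pow 2))).sqrt
      fun _ => (Jacobi.radicand_pos hk0 hk1 _).ne')

lemma hasDerivAt_uCn (hk0 : 0 ≤ k) (hk1 : k < 1) (x t : ℝ) :
    HasDerivAt (fun y => uCn k y t) (cnProfileDeriv k (x - cnSpeed k * t)) x :=
  (hasDerivAt_cnProfile hk0 hk1 _).comp_sub_const x _

lemma uCnX_eq (hk0 : 0 ≤ k) (hk1 : k < 1) (x t : ℝ) :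
    uCnX k x t = cnProfileDeriv k (x - cnSpeed k * t) :=
  (hasDerivAt_uCn hk0 hk1 x t).deriv

lemma hasDerivAt_uCn_x (hk0 : 0 ≤ k) (hk1 : k < 1) (x t : ℝ) :
    HasDerivAt (fun y => uCn k y t) (uCnX k x t) x := by
  rw [uCnX_eq hk0 hk1]; exact hasDerivAt_uCn hk0 hk1 x t

lemma hasDerivAt_comp_speed {f : ℝ → ℝ} {f' : ℝ} (x t c : ℝ) (hf : HasDerivAt f f' (x - c * t)) :
    HasDerivAt (fun s => f (x - c * s)) (-c * f') t := by
  have h : HasDerivAt (fun s : ℝ => x - c * s) (-c) t := by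
    simpa using ((hasDerivAt_id t).const_mul c).const_sub x
  have := hf.comp t h
  rwa [mul_comm] at this

lemma hasDerivAt_uCn_t (hk0 : 0 ≤ k) (hk1 : k < 1) (x t : ℝ) :
    HasDerivAt (fun s => uCn k x s) (-cnSpeed k * uCnX k x t) t := by
  rw [uCnX_eq hk0 hk1]
  exact hasDerivAt_comp_speed x t _ (hasDerivAt_cnProfile hk0 hk1 _)

lemma hasDerivAt_uCnX_x (hk0 : 0 ≤ k) (hk1 : k < 1) (x t : ℝ) :
    HasDerivAt (fun y => uCnX k y t) (cnSpeed k * uCn k x t - 2 * uCn k x t ^ 3) x := by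
  simp only [uCnX_eq hk0 hk1]
  exact (hasDerivAt_cnProfileDeriv hk0 hk1 _).comp_sub_const x _

lemma iteratedDeriv_two_uCn (hk0 : 0 ≤ k) (hk1 : k < 1) (x t : ℝ) :
    iteratedDeriv 2 (fun y => uCn k y t) x = cnSpeed k * uCn k x t - 2 * uCn k x t ^ 3 := by
  rw [iteratedDeriv_succ, iteratedDeriv_one]
  exact (hasDerivAt_uCnX_x hk0 hk1 x t).deriv

lemma hasDerivAt_uCnXX_x (hk0 : 0 ≤ k) (hk1 : k < 1) (x t : ℝ) :
    HasDerivAt (fun y => cnSpeed k * uCn k y t - 2 * uCn k y t ^ 3)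
      (cnSpeed k * uCnX k x t - 6 * uCn k x t ^ 2 * uCnX k x t) x := by
  have h := hasDerivAt_uCn_x hk0 hk1 x t
  refine ((h.const_mul _).sub ((h.pow 3).const_mul 2)).congr_deriv ?_
  norm_num; ring

lemma iteratedDeriv_three_uCn (hk0 : 0 ≤ k) (hk1 : k < 1) (x t : ℝ) :
    iteratedDeriv 3 (fun y => uCn k y t) x
      = cnSpeed k * uCnX k x t - 6 * uCn k x t ^ 2 * uCnX k x t := by
  rw [iteratedDeriv_succ, funext fun y => iteratedDeriv_two_uCn hk0 hk1 y t]
  exact (hasDerivAt_uCnXX_x hk0 hk1 x t).deriv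

lemma contDiff_uCn (hk0 : 0 ≤ k) (hk1 : k < 1) : ContDiff ℝ ∞ (fun p : ℝ × ℝ => uCn k p.1 p.2) :=
  (contDiff_cnProfile hk0 hk1).comp (contDiff_fst.sub (contDiff_const.mul contDiff_snd))

lemma contDiff_uCnX (hk0 : 0 ≤ k) (hk1 : k < 1) :
    ContDiff ℝ ∞ (fun p : ℝ × ℝ => uCnX k p.1 p.2) := by
  simp only [uCnX_eq hk0 hk1]
  exact (contDiff_cnProfileDeriv hk0 hk1).comp
    (contDiff_fst.sub (contDiff_const.mul contDiff_snd))

theorem isSolution_uCn (hk0 : 0 ≤ k) (hk1 : k < 1) : IsSolution (uCn k) := by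
  refine ⟨contDiff_uCn hk0 hk1, fun x t => ?_⟩
  rw [(hasDerivAt_uCn_t hk0 hk1 x t).deriv, (hasDerivAt_uCn_x hk0 hk1 x t).deriv,
    iteratedDeriv_three_uCn hk0 hk1]
  ring

lemma uCnX_sq (hk0 : 0 ≤ k) (hk1 : k < 1) (x t : ℝ) :
    uCnX k x t ^ 2 = (k ^ 2 - uCn k x t ^ 2) * (1 - k ^ 2 + uCn k x t ^ 2) := by
  rw [uCnX_eq hk0 hk1]; exact cnProfileDeriv_sq hk0 hk1 _

lemma abs_uCn_le (hk0 : 0 ≤ k) (x t : ℝ) : |uCn k x t| ≤ k := abs_cnProfile_le hk0 _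

lemma uCn_zero (hk0 : 0 ≤ k) (hk1 : k < 1) : uCn k 0 0 = k := by
  simp [uCn, cnProfile_zero hk0 hk1]

lemma uCnX_zero (hk0 : 0 ≤ k) (hk1 : k < 1) : uCnX k 0 0 = 0 := by
  simp [uCnX_eq hk0 hk1, cnProfileDeriv_zero hk0 hk1]

theorem isGreatest_cnAmplitudes (hk0 : 0 ≤ k) (hk1 : k < 1) : IsGreatest (cnAmplitudes k) k := by
  constructor
  · have hK : 0 ≤ Jacobi.ellipticK k := by
      have := (Jacobi.ellipticF_strictMono hk0 hk1).monotone Real.pi_div_two_pos.le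
      rwa [Jacobi.ellipticF_zero] at this
    exact ⟨0, ⟨by linarith, by linarith⟩, by simp [uCn_zero hk0 hk1, abs_of_nonneg hk0]⟩
  · rintro _ ⟨x, -, rfl⟩
    exact abs_uCn_le hk0 x 0

/-! ### The Darboux transformation for complex potentials -/

/-- `u` has the indicated derivatives and solves the mKdV equation at the points of `Ω`. -/
structure IsSolOn (Ω : Set (ℝ × ℝ)) (u u₁ u₂ u₃ ut : ℝ → ℝ → ℂ) : Prop where
  d₁ : ∀ x t, (x, t) ∈ Ω → HasDerivAt (fun y => u y t) (u₁ x t) x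
  d₂ : ∀ x t, (x, t) ∈ Ω → HasDerivAt (fun y => u₁ y t) (u₂ x t) x
  d₃ : ∀ x t, (x, t) ∈ Ω → HasDerivAt (fun y => u₂ y t) (u₃ x t) x
  dt : ∀ x t, (x, t) ∈ Ω → HasDerivAt (fun s => u x s) (ut x t) t
  eqn : ∀ x t, (x, t) ∈ Ω → ut x t + 6 * u x t ^ 2 * u₁ x t + u₃ x t = 0

/-- `(p, q)` solves the Lax pair with complex potential `u` at the points of `Ω`. -/
structure IsLaxOn (Ω : Set (ℝ × ℝ)) (lam : ℂ) (u u₁ u₂ p q : ℝ → ℝ → ℂ) : Prop where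
  px : ∀ x t, (x, t) ∈ Ω → HasDerivAt (fun y => p y t) (lam * p x t + u x t * q x t) x
  qx : ∀ x t, (x, t) ∈ Ω → HasDerivAt (fun y => q y t) (-u x t * p x t - lam * q x t) x
  pt : ∀ x t, (x, t) ∈ Ω → HasDerivAt (fun s => p x s)
      ((-4 * lam ^ 3 - 2 * lam * u x t ^ 2) * p x t
        + (-4 * lam ^ 2 * u x t - 2 * lam * u₁ x t - 2 * u x t ^ 3 - u₂ x t) * q x t) t
  qt : ∀ x t, (x, t) ∈ Ω → HasDerivAt (fun s => q x s)
      ((4 * lam ^ 2 * u x t - 2 * lam * u₁ x t + 2 * u x t ^ 3 + u₂ x t) * p x t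
        + (4 * lam ^ 3 + 2 * lam * u x t ^ 2) * q x t) t

/-- The sine of twice the angle of the vector `(p, q)`. -/
def dblSin (p q : ℝ → ℝ → ℂ) (x t : ℝ) : ℂ := 2 * p x t * q x t / (p x t ^ 2 + q x t ^ 2)

/-- The cosine of twice the angle of the vector `(p, q)`. -/
def dblCos (p q : ℝ → ℝ → ℂ) (x t : ℝ) : ℂ :=
  (p x t ^ 2 - q x t ^ 2) / (p x t ^ 2 + q x t ^ 2)

lemma dblSin_sq_add_dblCos_sq {p q : ℝ → ℝ → ℂ} {x t : ℝ} (h : p x t ^ 2 + q x t ^ 2 ≠ 0) :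
    dblSin p q x t ^ 2 + dblCos p q x t ^ 2 = 1 := by
  rw [dblSin, dblCos]; field_simp; ring

lemma hasDerivAt_two_mul_div {f g : ℝ → ℂ} {f' g' : ℂ} {x : ℝ}
    (hf : HasDerivAt f f' x) (hg : HasDerivAt g g' x) (h : f x ^ 2 + g x ^ 2 ≠ 0) :
    HasDerivAt (fun y => 2 * f y * g y / (f y ^ 2 + g y ^ 2))
      (2 * (f x ^ 2 - g x ^ 2) * (f x * g' - g x * f') / (f x ^ 2 + g x ^ 2) ^ 2) x := by
  refine (((hf.const_mul 2).mul hg).div ((hf.pow 2).add (hg.pow 2)) h).congr_deriv ?_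
  congr 1
  simp only [Pi.add_apply, Pi.mul_apply, Pi.pow_apply]
  push_cast
  ring

lemma hasDerivAt_sq_sub_sq_div {f g : ℝ → ℂ} {f' g' : ℂ} {x : ℝ}
    (hf : HasDerivAt f f' x) (hg : HasDerivAt g g' x) (h : f x ^ 2 + g x ^ 2 ≠ 0) :
    HasDerivAt (fun y => (f y ^ 2 - g y ^ 2) / (f y ^ 2 + g y ^ 2))
      (-4 * f x * g x * (f x * g' - g x * f') / (f x ^ 2 + g x ^ 2) ^ 2) x := by
  refine (((hf.pow 2).sub (hg.pow 2)).div ((hf.pow 2).add (hg.pow 2)) h).congr_deriv ?_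
  congr 1
  simp only [Pi.add_apply, Pi.sub_apply, Pi.pow_apply]
  push_cast
  ring

section OneFold

variable {Ω : Set (ℝ × ℝ)} {lam mu : ℂ} {u u₁ u₂ u₃ ut p q p₂ q₂ : ℝ → ℝ → ℂ} {x t : ℝ}

/-- With `(p, q) = ρ (cos φ, sin φ)` the Lax system closes on the angle: `(2φ)_x = -2(u + λ sin
2φ)`. The pair `(sin 2φ, cos 2φ)` is a polynomial form of this Riccati equation. -/
lemma IsLaxOn.hasDerivAt_dblSin_x (h : IsLaxOn Ω lam u u₁ u₂ p q) (hx : (x, t) ∈ Ω)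
    (ha : p x t ^ 2 + q x t ^ 2 ≠ 0) :
    HasDerivAt (fun y => dblSin p q y t)
      (-2 * dblCos p q x t * (u x t + lam * dblSin p q x t)) x := by
  refine (hasDerivAt_two_mul_div (h.px x t hx) (h.qx x t hx) ha).congr_deriv ?_
  rw [dblSin, dblCos]; field_simp; ring

lemma IsLaxOn.hasDerivAt_dblCos_x (h : IsLaxOn Ω lam u u₁ u₂ p q) (hx : (x, t) ∈ Ω)
    (ha : p x t ^ 2 + q x t ^ 2 ≠ 0) :
    HasDerivAt (fun y => dblCos p q y t)
      (2 * dblSin p q x t * (u x t + lam * dblSin p q x t)) x := by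
  refine (hasDerivAt_sq_sub_sq_div (h.px x t hx) (h.qx x t hx) ha).congr_deriv ?_
  rw [dblSin]; field_simp; ring

/-- The rate of change in time of twice the angle of an eigenvector. -/
def angleRate (lam v v₁ v₂ s c : ℂ) : ℂ :=
  8 * lam ^ 2 * v + 4 * v ^ 3 + 2 * v₂ - 4 * lam * v₁ * c + (8 * lam ^ 3 + 4 * lam * v ^ 2) * s

lemma IsLaxOn.hasDerivAt_dblSin_t (h : IsLaxOn Ω lam u u₁ u₂ p q) (hx : (x, t) ∈ Ω)
    (ha : p x t ^ 2 + q x t ^ 2 ≠ 0) :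
    HasDerivAt (fun s => dblSin p q x s) (dblCos p q x t *
      angleRate lam (u x t) (u₁ x t) (u₂ x t) (dblSin p q x t) (dblCos p q x t)) t := by
  refine (hasDerivAt_two_mul_div (h.pt x t hx) (h.qt x t hx) ha).congr_deriv ?_
  rw [angleRate, dblSin, dblCos]; field_simp; ring

lemma IsLaxOn.hasDerivAt_dblCos_t (h : IsLaxOn Ω lam u u₁ u₂ p q) (hx : (x, t) ∈ Ω)
    (ha : p x t ^ 2 + q x t ^ 2 ≠ 0) :
    HasDerivAt (fun s => dblCos p q x s) (-dblSin p q x t *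
      angleRate lam (u x t) (u₁ x t) (u₂ x t) (dblSin p q x t) (dblCos p q x t)) t := by
  refine (hasDerivAt_sq_sub_sq_div (h.pt x t hx) (h.qt x t hx) ha).congr_deriv ?_
  rw [angleRate, dblSin, dblCos]; field_simp; ring

/-- The one-fold Darboux transformation of `u`. -/
def darboux (lam : ℂ) (u p q : ℝ → ℝ → ℂ) (x t : ℝ) : ℂ := u x t + 2 * lam * dblSin p q x t

/-- The `x`-derivative of `darboux`. -/
def darboux₁ (lam : ℂ) (u u₁ p q : ℝ → ℝ → ℂ) (x t : ℝ) : ℂ :=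
  u₁ x t - 4 * lam * dblCos p q x t * (u x t + lam * dblSin p q x t)

/-- The second `x`-derivative of `darboux`. -/
def darboux₂ (lam : ℂ) (u u₁ u₂ p q : ℝ → ℝ → ℂ) (x t : ℝ) : ℂ :=
  u₂ x t - 4 * lam * (2 * dblSin p q x t * (u x t + lam * dblSin p q x t) ^ 2
    + dblCos p q x t * (u₁ x t - 2 * lam * dblCos p q x t * (u x t + lam * dblSin p q x t)))

/-- The third `x`-derivative of `darboux`. -/
def darboux₃ (lam : ℂ) (u u₁ u₂ u₃ p q : ℝ → ℝ → ℂ) (x t : ℝ) : ℂ :=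
  let s := dblSin p q x t
  let c := dblCos p q x t
  let g := u x t + lam * s
  let g₁ := u₁ x t - 2 * lam * c * g
  let g₂ := u₂ x t - 2 * lam * (2 * s * g ^ 2 + c * g₁)
  u₃ x t - 4 * lam * (-4 * c * g ^ 3 + 6 * s * g * g₁ + c * g₂)

/-- In the double-angle variables all derivatives are polynomial, and the new mKdV residual vanishes
modulo the old one and `s² + c² = 1`. -/
theorem IsSolOn.darboux (hu : IsSolOn Ω u u₁ u₂ u₃ ut) (h : IsLaxOn Ω lam u u₁ u₂ p q)
    (ha : ∀ x t, (x, t) ∈ Ω → p x t ^ 2 + q x t ^ 2 ≠ 0) :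
    IsSolOn Ω (darboux lam u p q) (darboux₁ lam u u₁ p q) (darboux₂ lam u u₁ u₂ p q)
      (darboux₃ lam u u₁ u₂ u₃ p q)
      (fun x t => ut x t + 2 * lam * (dblCos p q x t *
        angleRate lam (u x t) (u₁ x t) (u₂ x t) (dblSin p q x t) (dblCos p q x t))) where
  d₁ x t hx := by
    have hs := h.hasDerivAt_dblSin_x hx (ha x t hx)
    refine ((hu.d₁ x t hx).add (hs.const_mul (2 * lam))).congr_deriv ?_
    rw [darboux₁]; ring
  d₂ x t hx := by
    have hs := h.hasDerivAt_dblSin_x hx (ha x t hx)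
    have hc := h.hasDerivAt_dblCos_x hx (ha x t hx)
    have hg := (hu.d₁ x t hx).add (hs.const_mul lam)
    refine ((hu.d₂ x t hx).sub ((hc.const_mul (4 * lam)).mul hg)).congr_deriv ?_
    simp only [Pi.add_apply, darboux₂]; ring
  d₃ x t hx := by
    have hs := h.hasDerivAt_dblSin_x hx (ha x t hx)
    have hc := h.hasDerivAt_dblCos_x hx (ha x t hx)
    have hg := (hu.d₁ x t hx).add (hs.const_mul lam)
    refine ((hu.d₃ x t hx).sub ((((hs.const_mul 2).mul (hg.pow 2)).add
      (hc.mul ((hu.d₂ x t hx).sub ((hc.const_mul (2 * lam)).mul hg)))).const_mul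
        (4 * lam))).congr_deriv ?_
    simp only [Pi.add_apply, Pi.pow_apply, Pi.sub_apply, Pi.mul_apply, darboux₃]
    push_cast
    ring
  dt x t hx := (hu.dt x t hx).add ((h.hasDerivAt_dblSin_t hx (ha x t hx)).const_mul (2 * lam))
  eqn x t hx := by
    have h1 := dblSin_sq_add_dblCos_sq (ha x t hx)
    have h2 := hu.eqn x t hx
    simp only [darboux₁, darboux₃, MKdV.darboux, angleRate]
    generalize dblSin p q x t = s at *
    generalize dblCos p q x t = c at *
    generalize u x t = v at *
    generalize u₁ x t = v₁ at *
    generalize u₂ x t = v₂ at *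
    generalize u₃ x t = v₃ at *
    generalize ut x t = vt at *
    grind

/-- The Darboux transformation of a further eigenvector `(p₂, q₂)`, first component. -/
def darbouxFst (lam mu : ℂ) (p q p₂ q₂ : ℝ → ℝ → ℂ) (x t : ℝ) : ℂ :=
  (mu - lam * dblCos p q x t) * p₂ x t - lam * dblSin p q x t * q₂ x t

/-- The Darboux transformation of a further eigenvector `(p₂, q₂)`, second component. -/
def darbouxSnd (lam mu : ℂ) (p q p₂ q₂ : ℝ → ℝ → ℂ) (x t : ℝ) : ℂ :=
  -lam * dblSin p q x t * p₂ x t + (mu + lam * dblCos p q x t) * q₂ x t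

/-- The dressing matrix is `μ - λR`, where `R = (c, s; s, -c)` is the reflection fixing `(p, q)`. -/
theorem IsLaxOn.darboux (h : IsLaxOn Ω lam u u₁ u₂ p q) (h₂ : IsLaxOn Ω mu u u₁ u₂ p₂ q₂)
    (ha : ∀ x t, (x, t) ∈ Ω → p x t ^ 2 + q x t ^ 2 ≠ 0) :
    IsLaxOn Ω mu (darboux lam u p q) (darboux₁ lam u u₁ p q) (darboux₂ lam u u₁ u₂ p q)
      (darbouxFst lam mu p q p₂ q₂) (darbouxSnd lam mu p q p₂ q₂) where
  px x t hx := by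
    have hs := h.hasDerivAt_dblSin_x hx (ha x t hx)
    have hc := h.hasDerivAt_dblCos_x hx (ha x t hx)
    refine ((((hc.const_mul lam).const_sub mu).mul (h₂.px x t hx)).sub
      ((hs.const_mul lam).mul (h₂.qx x t hx))).congr_deriv ?_
    simp only [MKdV.darboux, darbouxFst, darbouxSnd]; ring
  qx x t hx := by
    have hs := h.hasDerivAt_dblSin_x hx (ha x t hx)
    have hc := h.hasDerivAt_dblCos_x hx (ha x t hx)
    refine (((hs.const_mul (-lam)).mul (h₂.px x t hx)).add
      (((hc.const_mul lam).const_add mu).mul (h₂.qx x t hx))).congr_deriv ?_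
    simp only [MKdV.darboux, darbouxFst, darbouxSnd]; ring
  pt x t hx := by
    have hs := h.hasDerivAt_dblSin_t hx (ha x t hx)
    have hc := h.hasDerivAt_dblCos_t hx (ha x t hx)
    refine ((((hc.const_mul lam).const_sub mu).mul (h₂.pt x t hx)).sub
      ((hs.const_mul lam).mul (h₂.qt x t hx))).congr_deriv ?_
    have h1 := dblSin_sq_add_dblCos_sq (ha x t hx)
    simp only [MKdV.darboux, darbouxFst, darbouxSnd, angleRate, darboux₁, darboux₂]
    generalize dblSin p q x t = s at *
    generalize dblCos p q x t = c at *
    generalize u x t = v at *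
    generalize u₁ x t = v₁ at *
    generalize u₂ x t = v₂ at *
    generalize p₂ x t = p₂ at *
    generalize q₂ x t = q₂ at *
    grind
  qt x t hx := by
    have hs := h.hasDerivAt_dblSin_t hx (ha x t hx)
    have hc := h.hasDerivAt_dblCos_t hx (ha x t hx)
    refine (((hs.const_mul (-lam)).mul (h₂.pt x t hx)).add
      (((hc.const_mul lam).const_add mu).mul (h₂.qt x t hx))).congr_deriv ?_
    have h1 := dblSin_sq_add_dblCos_sq (ha x t hx)
    simp only [MKdV.darboux, darbouxFst, darbouxSnd, angleRate, darboux₁, darboux₂]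
    generalize dblSin p q x t = s at *
    generalize dblCos p q x t = c at *
    generalize u x t = v at *
    generalize u₁ x t = v₁ at *
    generalize u₂ x t = v₂ at *
    generalize p₂ x t = p₂ at *
    generalize q₂ x t = q₂ at *
    grind

/-- `R` is symmetric with `R² = 1`, so the sum of squares is the quadratic form of `(μ - λR)² = μ² +
λ² - 2λμR`. This is where the two-fold denominator comes from. -/
lemma darbouxFst_sq_add_darbouxSnd_sq (ha : p x t ^ 2 + q x t ^ 2 ≠ 0) :
    darbouxFst lam mu p q p₂ q₂ x t ^ 2 + darbouxSnd lam mu p q p₂ q₂ x t ^ 2 =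
      twoFoldDenom lam mu (p x t) (q x t) (p₂ x t) (q₂ x t) / (p x t ^ 2 + q x t ^ 2) := by
  simp only [darbouxFst, darbouxSnd, dblSin, dblCos, twoFoldDenom]
  field_simp
  ring

lemma darboux_darboux (ha : p x t ^ 2 + q x t ^ 2 ≠ 0)
    (hd : twoFoldDenom lam mu (p x t) (q x t) (p₂ x t) (q₂ x t) ≠ 0) :
    darboux mu (darboux lam u p q) (darbouxFst lam mu p q p₂ q₂) (darbouxSnd lam mu p q p₂ q₂) x t
      = twoFoldDarboux (u x t) lam mu (p x t) (q x t) (p₂ x t) (q₂ x t) := by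
  have h2 : 2 * darbouxFst lam mu p q p₂ q₂ x t * darbouxSnd lam mu p q p₂ q₂ x t =
      2 * ((mu ^ 2 + lam ^ 2) * p₂ x t * q₂ x t * (p x t ^ 2 + q x t ^ 2) ^ 2
        - 2 * lam * mu * p x t * q x t * (p₂ x t ^ 2 + q₂ x t ^ 2) * (p x t ^ 2 + q x t ^ 2)
        + 2 * lam ^ 2 * (p x t * q x t * (p x t ^ 2 - q x t ^ 2) * (p₂ x t ^ 2 - q₂ x t ^ 2)
          - p₂ x t * q₂ x t * (p x t ^ 2 - q x t ^ 2) ^ 2)) / (p x t ^ 2 + q x t ^ 2) ^ 2 := by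
    simp only [darbouxFst, darbouxSnd, dblSin, dblCos]
    field_simp
    ring
  rw [darboux, dblSin, h2, darbouxFst_sq_add_darbouxSnd_sq ha, darboux, dblSin, twoFoldDarboux]
  field_simp
  rw [twoFoldDenom]
  ring

/-- The two-fold Darboux transformation yields solutions of the mKdV equation. -/
theorem exists_isSolOn_twoFoldDarboux (hu : IsSolOn Ω u u₁ u₂ u₃ ut)
    (h : IsLaxOn Ω lam u u₁ u₂ p q) (h₂ : IsLaxOn Ω mu u u₁ u₂ p₂ q₂)
    (ha : ∀ x t, (x, t) ∈ Ω → p x t ^ 2 + q x t ^ 2 ≠ 0)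
    (hd : ∀ x t, (x, t) ∈ Ω → twoFoldDenom lam mu (p x t) (q x t) (p₂ x t) (q₂ x t) ≠ 0) :
    ∃ v v₁ v₂ v₃ vt : ℝ → ℝ → ℂ, IsSolOn Ω v v₁ v₂ v₃ vt ∧ ∀ x t, (x, t) ∈ Ω →
      v x t = twoFoldDarboux (u x t) lam mu (p x t) (q x t) (p₂ x t) (q₂ x t) := by
  refine ⟨_, _, _, _, _, (hu.darboux h ha).darboux (h.darboux h₂ ha) fun x t hx => ?_,
    fun x t hx => darboux_darboux (ha x t hx) (hd x t hx)⟩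
  rw [darbouxFst_sq_add_darbouxSnd_sq (ha x t hx)]
  exact div_ne_zero (hd x t hx) (ha x t hx)

end OneFold

/-! ### The eigenvalue and the function `θ` -/

section Theta

variable {k : ℝ}

lemma sqrt_one_sub_sq_pos (hk0 : 0 < k) (hk1 : k < 1) : 0 < Real.sqrt (1 - k ^ 2) :=
  Real.sqrt_pos.mpr (by nlinarith)

lemma sq_sqrt_one_sub_sq (hk0 : 0 < k) (hk1 : k < 1) : Real.sqrt (1 - k ^ 2) ^ 2 = 1 - k ^ 2 :=
  Real.sq_sqrt (by nlinarith)

lemma kap_pos (hk0 : 0 < k) (hk1 : k < 1) : 0 < kap k :=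
  mul_pos hk0 (sqrt_one_sub_sq_pos hk0 hk1)

lemma kap_sq (hk0 : 0 < k) (hk1 : k < 1) : kap k ^ 2 = k ^ 2 * (1 - k ^ 2) := by
  rw [kap, mul_pow, sq_sqrt_one_sub_sq hk0 hk1]

lemma lamI_ne_zero (hk0 : 0 < k) : lamI k ≠ 0 := by
  intro h
  have := congrArg Complex.re h
  simp [lamI] at this
  exact hk0.ne' this

lemma four_mul_lamI_sq (hk0 : 0 < k) (hk1 : k < 1) :
    4 * lamI k ^ 2 = (cnSpeed k : ℂ) + 2 * Complex.I * (kap k : ℂ) := by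
  have h : ((Real.sqrt (1 - k ^ 2) : ℝ) : ℂ) ^ 2 = 1 - (k : ℂ) ^ 2 := by
    exact_mod_cast congrArg (fun r : ℝ => (r : ℂ)) (sq_sqrt_one_sub_sq hk0 hk1)
  rw [lamI, cnSpeed, kap]
  push_cast
  linear_combination (Real.sqrt (1 - k ^ 2) : ℂ) ^ 2 * Complex.I_sq - h

lemma four_mul_lamI_mul_conj (hk0 : 0 < k) (hk1 : k < 1) :
    4 * lamI k * starRingEnd ℂ (lamI k) = 1 := by
  have h : ((Real.sqrt (1 - k ^ 2) : ℝ) : ℂ) ^ 2 = 1 - (k : ℂ) ^ 2 := by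
    exact_mod_cast congrArg (fun r : ℝ => (r : ℂ)) (sq_sqrt_one_sub_sq hk0 hk1)
  simp only [lamI, map_div₀, map_add, map_mul, Complex.conj_ofReal, Complex.conj_I, map_ofNat]
  linear_combination -(Real.sqrt (1 - k ^ 2) : ℂ) ^ 2 * Complex.I_sq + h

lemma norm_lamI (hk0 : 0 < k) (hk1 : k < 1) : ‖lamI k‖ = 1 / 2 := by
  have h := congrArg norm (four_mul_lamI_mul_conj hk0 hk1)
  simp only [norm_mul, RCLike.norm_conj, norm_one, RCLike.norm_ofNat] at h
  nlinarith [norm_nonneg (lamI k)]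

/-- `u² + iκ` never vanishes. -/
lemma sq_add_kap_ne_zero (hk0 : 0 < k) (hk1 : k < 1) (v : ℝ) :
    (v : ℂ) ^ 2 + Complex.I * (kap k : ℂ) ≠ 0 := by
  intro h
  have := congrArg Complex.im h
  rw [← Complex.ofReal_pow] at this
  simp [-Complex.ofReal_pow] at this
  exact (kap_pos hk0 hk1).ne' this

lemma kap_le_norm (hk0 : 0 < k) (hk1 : k < 1) (v : ℝ) :
    kap k ≤ ‖(v : ℂ) ^ 2 + Complex.I * (kap k : ℂ)‖ := by
  refine le_trans (le_of_eq ?_) (Complex.abs_im_le_norm _)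
  rw [← Complex.ofReal_pow]
  simp [-Complex.ofReal_pow, abs_of_pos (kap_pos hk0 hk1)]

/-- The integrand in the definition of `θ`. -/
def thetaIntegrand (k y : ℝ) : ℂ :=
  (cnProfile k y : ℂ) ^ 2 / ((cnProfile k y : ℂ) ^ 2 + Complex.I * (kap k : ℂ)) ^ 2

/-- The integral in the definition of `θ`. -/
def thetaIntegral (k ξ : ℝ) : ℂ := ∫ y in (0 : ℝ)..ξ, thetaIntegrand k y

lemma thetaCn_eq (x t : ℝ) :
    thetaCn k x t = -4 * lamI k * ((uCn k x t : ℂ) ^ 2 + Complex.I * (kap k : ℂ)) *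
      (thetaIntegral k (x - cnSpeed k * t) - t) := rfl

lemma contDiff_thetaIntegrand (hk0 : 0 < k) (hk1 : k < 1) : ContDiff ℝ ∞ (thetaIntegrand k) := by
  have h : ContDiff ℝ ∞ (fun y => (cnProfile k y : ℂ)) :=
    Complex.ofRealCLM.contDiff.comp (contDiff_cnProfile hk0.le hk1)
  exact (h.pow 2).mul ((((h.pow 2).add contDiff_const).pow 2).inv
    fun y => pow_ne_zero 2 (sq_add_kap_ne_zero hk0 hk1 _))

lemma hasDerivAt_thetaIntegral (hk0 : 0 < k) (hk1 : k < 1) (ξ : ℝ) :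
    HasDerivAt (thetaIntegral k) (thetaIntegrand k ξ) ξ :=
  ((contDiff_thetaIntegrand hk0 hk1).continuous.integral_hasStrictDerivAt 0 ξ).hasDerivAt

lemma contDiff_thetaIntegral (hk0 : 0 < k) (hk1 : k < 1) : ContDiff ℝ ∞ (thetaIntegral k) := by
  rw [contDiff_infty_iff_deriv]
  refine ⟨fun ξ => (hasDerivAt_thetaIntegral hk0 hk1 ξ).differentiableAt, ?_⟩
  rw [funext fun ξ => (hasDerivAt_thetaIntegral hk0 hk1 ξ).deriv]
  exact contDiff_thetaIntegrand hk0 hk1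

lemma contDiff_thetaCn (hk0 : 0 < k) (hk1 : k < 1) :
    ContDiff ℝ ∞ (fun p : ℝ × ℝ => thetaCn k p.1 p.2) := by
  have h : ContDiff ℝ ∞ (fun p : ℝ × ℝ => (uCn k p.1 p.2 : ℂ)) :=
    Complex.ofRealCLM.contDiff.comp (contDiff_uCn hk0.le hk1)
  have h2 : ContDiff ℝ ∞ (fun p : ℝ × ℝ => thetaIntegral k (p.1 - cnSpeed k * p.2)) :=
    (contDiff_thetaIntegral hk0 hk1).comp (contDiff_fst.sub (contDiff_const.mul contDiff_snd))
  have h3 : ContDiff ℝ ∞ (fun p : ℝ × ℝ => (p.2 : ℂ)) :=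
    Complex.ofRealCLM.contDiff.comp contDiff_snd
  exact (contDiff_const.mul ((h.pow 2).add contDiff_const)).mul (h2.sub h3)

lemma hasDerivAt_thetaCn_x (hk0 : 0 < k) (hk1 : k < 1) (x t : ℝ) :
    HasDerivAt (fun y => thetaCn k y t)
      ((2 * uCn k x t * uCnX k x t * thetaCn k x t - 4 * lamI k * (uCn k x t : ℂ) ^ 2) /
        ((uCn k x t : ℂ) ^ 2 + Complex.I * (kap k : ℂ))) x := by
  have hu := (hasDerivAt_uCn_x hk0.le hk1 x t).ofReal_comp
  have hI := (hasDerivAt_thetaIntegral hk0 hk1 (x - cnSpeed k * t)).comp_sub_const x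
    (cnSpeed k * t)
  have hW := sq_add_kap_ne_zero hk0 hk1 (uCn k x t)
  refine ((((hu.pow 2).add_const _).const_mul (-4 * lamI k)).mul
    (hI.sub_const (t : ℂ))).congr_deriv ?_
  simp only [thetaCn_eq, thetaIntegrand]
  change _ + _ * ((uCn k x t : ℂ) ^ 2 / ((uCn k x t : ℂ) ^ 2 + Complex.I * (kap k : ℂ)) ^ 2) = _
  simp only [Pi.pow_apply]
  field_simp
  push_cast
  ring

lemma hasDerivAt_thetaCn_t (hk0 : 0 < k) (hk1 : k < 1) (x t : ℝ) :
    HasDerivAt (fun s => thetaCn k x s)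
      (-cnSpeed k *
        ((2 * uCn k x t * uCnX k x t * thetaCn k x t - 4 * lamI k * (uCn k x t : ℂ) ^ 2) /
          ((uCn k x t : ℂ) ^ 2 + Complex.I * (kap k : ℂ)))
        + 4 * lamI k * ((uCn k x t : ℂ) ^ 2 + Complex.I * (kap k : ℂ))) t := by
  have hu := (hasDerivAt_uCn_t hk0.le hk1 x t).ofReal_comp
  have hg : HasDerivAt (fun s : ℝ => x - cnSpeed k * s) (-cnSpeed k) t := by
    simpa using ((hasDerivAt_id t).const_mul (cnSpeed k)).const_sub x
  have hI := (hasDerivAt_thetaIntegral hk0 hk1 (x - cnSpeed k * t)).scomp t hg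
  have hW := sq_add_kap_ne_zero hk0 hk1 (uCn k x t)
  refine ((((hu.pow 2).add_const _).const_mul (-4 * lamI k)).mul
    (hI.sub (hasDerivAt_id t).ofReal_comp)).congr_deriv ?_
  simp only [thetaCn_eq, thetaIntegrand, Pi.pow_apply, Complex.real_smul, Pi.sub_apply,
    Function.comp_apply, id]
  change _ + _ * (_ * ((uCn k x t : ℂ) ^ 2 / ((uCn k x t : ℂ) ^ 2 +
    Complex.I * (kap k : ℂ)) ^ 2) - _) = _
  field_simp
  push_cast
  ring

/-- The point is the constant sign, which forces the integral to grow in the imaginary direction. -/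
lemma thetaIntegrand_im (hk0 : 0 < k) (hk1 : k < 1) (y : ℝ) :
    (thetaIntegrand k y).im =
      -(2 * kap k * cnProfile k y ^ 4 / (cnProfile k y ^ 4 + kap k ^ 2) ^ 2) := by
  have hκ := kap_pos hk0 hk1
  have h : thetaIntegrand k y =
      (((cnProfile k y ^ 6 - kap k ^ 2 * cnProfile k y ^ 2) /
        (cnProfile k y ^ 4 + kap k ^ 2) ^ 2 : ℝ) : ℂ) +
      ((-(2 * kap k * cnProfile k y ^ 4 / (cnProfile k y ^ 4 + kap k ^ 2) ^ 2) : ℝ) : ℂ)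
        * Complex.I := by
    have h1 := sq_add_kap_ne_zero hk0 hk1 (cnProfile k y)
    have h2 : (cnProfile k y : ℂ) ^ 4 + (kap k : ℂ) ^ 2 ≠ 0 := by
      have : cnProfile k y ^ 4 + kap k ^ 2 ≠ 0 := by positivity
      exact_mod_cast this
    have h3 : (cnProfile k y : ℂ) ^ 4 + (kap k : ℂ) ^ 2 =
        ((cnProfile k y : ℂ) ^ 2 + Complex.I * (kap k : ℂ)) *
          ((cnProfile k y : ℂ) ^ 2 - Complex.I * (kap k : ℂ)) := by
      linear_combination (kap k : ℂ) ^ 2 * Complex.I_sq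
    rw [thetaIntegrand]
    push_cast
    rw [h3] at h2 ⊢
    have h4 := right_ne_zero_of_mul h2
    field_simp
    linear_combination (cnProfile k y : ℂ) ^ 2 * (kap k : ℂ) ^ 2 * Complex.I_sq
  rw [h, Complex.add_im, Complex.ofReal_im, Complex.mul_I_im, Complex.ofReal_re, zero_add]

lemma norm_thetaIntegral_le (hk0 : 0 < k) (hk1 : k < 1) (ξ : ℝ) :
    ‖thetaIntegral k ξ‖ ≤ k ^ 2 / kap k ^ 2 * |ξ| := by
  have hκ := kap_pos hk0 hk1
  have := intervalIntegral.norm_integral_le_of_norm_le_const (a := 0) (b := ξ)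
    (f := thetaIntegrand k) (C := k ^ 2 / kap k ^ 2) (fun y _ => ?_)
  · simpa [thetaIntegral] using this
  · rw [thetaIntegrand, norm_div, norm_pow, norm_pow, Complex.norm_real, Real.norm_eq_abs]
    have := abs_cnProfile_le hk0.le y
    have := kap_le_norm hk0 hk1 (cnProfile k y)
    gcongr

lemma thetaIntegral_im (hk0 : 0 < k) (hk1 : k < 1) (ξ : ℝ) :
    -(thetaIntegral k ξ).im = ∫ y in (0 : ℝ)..ξ,
      2 * kap k * cnProfile k y ^ 4 / (cnProfile k y ^ 4 + kap k ^ 2) ^ 2 := by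
  have h := Complex.imCLM.intervalIntegral_comp_comm
    ((contDiff_thetaIntegrand hk0 hk1).continuous.intervalIntegrable
      (μ := MeasureTheory.volume) 0 ξ)
  simp only [Complex.imCLM_apply, thetaIntegrand_im hk0 hk1] at h
  rw [thetaIntegral, ← h, intervalIntegral.integral_neg, neg_neg]

lemma tendsto_thetaIntegral_im (hk0 : 0 < k) (hk1 : k < 1) :
    Filter.Tendsto (fun ξ => -(thetaIntegral k ξ).im) Filter.atTop Filter.atTop ∧
    Filter.Tendsto (fun ξ => -(thetaIntegral k ξ).im) Filter.atBot Filter.atBot := by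
  have hκ := kap_pos hk0 hk1
  have hT := Jacobi.period_pos hk0.le hk1
  have hper : Function.Periodic (fun y => 2 * kap k * cnProfile k y ^ 4 /
      (cnProfile k y ^ 4 + kap k ^ 2) ^ 2) (Jacobi.period k) := by
    intro y
    simp only [periodic_cnProfile hk0.le hk1 y]
  have hU : Continuous (cnProfile k) := (contDiff_cnProfile hk0.le hk1).continuous
  have hcont : Continuous (fun y => 2 * kap k * cnProfile k y ^ 4 /
      (cnProfile k y ^ 4 + kap k ^ 2) ^ 2) :=
    (continuous_const.mul (hU.pow 4)).div (((hU.pow 4).add continuous_const).pow 2)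
      fun y => by positivity
  have hpos : 0 < ∫ y in (0 : ℝ)..Jacobi.period k, 2 * kap k * cnProfile k y ^ 4 /
      (cnProfile k y ^ 4 + kap k ^ 2) ^ 2 :=
    intervalIntegral.integral_pos hT hcont.continuousOn (fun y _ => by positivity)
      ⟨0, ⟨le_rfl, hT.le⟩, by rw [cnProfile_zero hk0.le hk1]; positivity⟩
  simp only [thetaIntegral_im hk0 hk1]
  have hint : ∀ a b, IntervalIntegrable (fun y => 2 * kap k * cnProfile k y ^ 4 /
      (cnProfile k y ^ 4 + kap k ^ 2) ^ 2) MeasureTheory.volume a b :=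
    fun a b => hcont.intervalIntegrable a b
  exact ⟨hper.tendsto_atTop_intervalIntegral_of_pos hpos hT,
    hper.tendsto_atBot_intervalIntegral_of_pos hpos hT⟩

/-- A bound on `θ` bounds the integral minus `t`. The imaginary part does not involve `t` and bounds
`ξ = x - ct`; the real part then bounds `t`, and so `x`. -/
theorem tendsto_norm_thetaCn (hk0 : 0 < k) (hk1 : k < 1) :
    Filter.Tendsto (fun p : ℝ × ℝ => ‖thetaCn k p.1 p.2‖)
      (Filter.comap (fun p : ℝ × ℝ => |p.1| + |p.2|) Filter.atTop) Filter.atTop := by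
  have hκ := kap_pos hk0 hk1
  rw [Filter.tendsto_atTop]
  intro N
  obtain ⟨h1, h2⟩ := tendsto_thetaIntegral_im hk0 hk1
  obtain ⟨a, ha⟩ := Filter.eventually_atTop.mp
    (h1.eventually (Filter.eventually_gt_atTop (N / (2 * kap k))))
  obtain ⟨b, hb⟩ := Filter.eventually_atBot.mp
    (h2.eventually (Filter.eventually_lt_atBot (-(N / (2 * kap k)))))
  set R := max |a| |b| with hR
  set M := N / (2 * kap k) + k ^ 2 / kap k ^ 2 * R with hM
  rw [Filter.eventually_comap]
  filter_upwards [Filter.eventually_gt_atTop (R + |cnSpeed k| * M + M)] with r hr p hp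
  by_contra! hlt
  obtain ⟨x, t⟩ := p
  simp only at hp hlt
  set ξ := x - cnSpeed k * t with hξ
  -- From `|λ_I| = 1/2` and `|u² + iκ| ≥ κ` one has `|θ| ≥ 2κ |I(ξ) - t|`.
  have hn : ‖thetaIntegral k ξ - t‖ < N / (2 * kap k) := by
    rw [lt_div_iff₀ (by positivity)]
    refine lt_of_le_of_lt ?_ hlt
    rw [thetaCn_eq, norm_mul, norm_mul, norm_mul, norm_lamI hk0 hk1, norm_neg, RCLike.norm_ofNat]
    have := kap_le_norm hk0 hk1 (uCn k x t)
    have := norm_nonneg (thetaIntegral k ξ - t)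
    nlinarith
  have him : |(thetaIntegral k ξ).im| < N / (2 * kap k) := by
    have := Complex.abs_im_le_norm (thetaIntegral k ξ - t)
    simp only [Complex.sub_im, Complex.ofReal_im, sub_zero] at this
    exact this.trans_lt hn
  have hξa : ξ < a := by
    by_contra! h
    have := ha ξ h
    linarith [neg_abs_le (thetaIntegral k ξ).im]
  have hξb : b < ξ := by
    by_contra! h
    have := hb ξ h
    linarith [le_abs_self (thetaIntegral k ξ).im]
  have hξR : |ξ| ≤ R := by
    rw [abs_le]
    constructor
    · linarith [neg_abs_le b, le_max_right |a| |b|]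
    · linarith [le_abs_self a, le_max_left |a| |b|]
  have ht : |t| ≤ M := by
    have h3 : ‖(t : ℂ)‖ ≤ ‖thetaIntegral k ξ‖ + ‖thetaIntegral k ξ - t‖ := by
      have := norm_sub_le (thetaIntegral k ξ) (thetaIntegral k ξ - t)
      rwa [sub_sub_cancel] at this
    rw [Complex.norm_real, Real.norm_eq_abs] at h3
    have h4 := norm_thetaIntegral_le hk0 hk1 ξ
    have h5 : k ^ 2 / kap k ^ 2 * |ξ| ≤ k ^ 2 / kap k ^ 2 * R := by gcongr
    linarith
  have hx : |x| ≤ R + |cnSpeed k| * M := by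
    have h3 : x = ξ + cnSpeed k * t := by rw [hξ]; ring
    have h4 := abs_add_le ξ (cnSpeed k * t)
    rw [← h3, abs_mul] at h4
    have h5 : |cnSpeed k| * |t| ≤ |cnSpeed k| * M := by gcongr
    linarith
  linarith

end Theta

/-! ### The eigenfunctions -/

section Eigenfunctions

variable {k : ℝ} {lam : ℂ} {p q φ₁ φ₂ : ℝ → ℝ → ℂ}

/-- The Lax pair for the cn-periodic wave. -/
abbrev IsCnLaxOn (k : ℝ) (Ω : Set (ℝ × ℝ)) (lam : ℂ) (p q : ℝ → ℝ → ℂ) : Prop :=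
  IsLaxOn Ω lam (fun x t => (uCn k x t : ℂ)) (fun x t => (uCnX k x t : ℂ))
    (fun x t => (cnSpeed k : ℂ) * uCn k x t - 2 * (uCn k x t : ℂ) ^ 3) p q

lemma isLaxSolution_uCn_iff (hk0 : 0 < k) (hk1 : k < 1) :
    IsLaxSolution lam (uCn k) p q ↔ IsCnLaxOn k Set.univ lam p q := by
  have h2 : ∀ x t, ((iteratedDeriv 2 (fun y => uCn k y t) x : ℝ) : ℂ) =
      (cnSpeed k : ℂ) * uCn k x t - 2 * (uCn k x t : ℂ) ^ 3 := by
    intro x t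
    rw [iteratedDeriv_two_uCn hk0.le hk1]
    push_cast
    rfl
  constructor
  · intro h
    simp only [IsLaxSolution, h2] at h
    exact ⟨fun x t _ => (h x t).1, fun x t _ => (h x t).2.1, fun x t _ => (h x t).2.2.1,
      fun x t _ => (h x t).2.2.2⟩
  · intro h x t
    simp only [h2]
    exact ⟨h.px x t trivial, h.qx x t trivial, h.pt x t trivial, h.qt x t trivial⟩

lemma IsCnLaxOn.conj {Ω : Set (ℝ × ℝ)} (h : IsCnLaxOn k Ω lam p q) :
    IsCnLaxOn k Ω (starRingEnd ℂ lam) (fun x t => starRingEnd ℂ (p x t))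
      (fun x t => starRingEnd ℂ (q x t)) where
  px x t hx := (h.px x t hx).star.congr_deriv (by simp)
  qx x t hx := (h.qx x t hx).star.congr_deriv (by simp)
  pt x t hx := (h.pt x t hx).star.congr_deriv (by simp)
  qt x t hx := (h.qt x t hx).star.congr_deriv (by simp)

lemma cnSpeed_eq (hk0 : 0 < k) (hk1 : k < 1) :
    (cnSpeed k : ℂ) = 4 * lamI k ^ 2 - 2 * (Complex.I * (kap k : ℂ)) := by
  linear_combination -four_mul_lamI_sq hk0 hk1

/-- The energy integral as a perfect square. It says `φ₁² · φ₂² = (φ₁φ₂)²` for the values prescribed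
by the normalization. -/
lemma uCnX_sq_complex (hk0 : 0 < k) (hk1 : k < 1) (x t : ℝ) :
    4 * lamI k ^ 2 * (uCn k x t : ℂ) ^ 2 - (uCnX k x t : ℂ) ^ 2 =
      ((uCn k x t : ℂ) ^ 2 + Complex.I * (kap k : ℂ)) ^ 2 := by
  have h1 : (uCnX k x t : ℂ) ^ 2 =
      ((k : ℂ) ^ 2 - (uCn k x t : ℂ) ^ 2) * (1 - (k : ℂ) ^ 2 + (uCn k x t : ℂ) ^ 2) := by
    exact_mod_cast congrArg (fun r : ℝ => (r : ℂ)) (uCnX_sq hk0.le hk1 x t)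
  have h2 : (kap k : ℂ) ^ 2 = (k : ℂ) ^ 2 * (1 - (k : ℂ) ^ 2) := by
    exact_mod_cast congrArg (fun r : ℝ => (r : ℂ)) (kap_sq hk0 hk1)
  have h3 := four_mul_lamI_sq hk0 hk1
  rw [cnSpeed] at h3
  push_cast at h3
  rw [h1, h3]
  linear_combination h2 - (kap k : ℂ) ^ 2 * Complex.I_sq

/-- The algebraic relations between an eigenfunction and the cn-periodic wave. -/
structure IsCnEigenvector (k x t : ℝ) (P Q : ℂ) : Prop where
  u : (uCn k x t : ℂ) = P ^ 2 + Q ^ 2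
  ux : (uCnX k x t : ℂ) = 2 * lamI k * (P ^ 2 - Q ^ 2)
  W : (uCn k x t : ℂ) ^ 2 + Complex.I * (kap k : ℂ) = -4 * lamI k * P * Q
  P_ne : P ≠ 0
  Q_ne : Q ≠ 0

/-- With this, `u`, `u_x` and `c` are all polynomials in `λ_I, P, Q`, so the time equations of the
Lax pair become identities in three free variables. -/
lemma IsCnEigenvector.speed (hk0 : 0 < k) (hk1 : k < 1) {x t : ℝ} {P Q : ℂ}
    (h : IsCnEigenvector k x t P Q) :
    (cnSpeed k : ℂ) = 4 * lamI k ^ 2 + 8 * lamI k * P * Q + 2 * (P ^ 2 + Q ^ 2) ^ 2 := by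
  rw [cnSpeed_eq hk0 hk1, ← h.u]
  linear_combination -2 * h.W

lemma isCnEigenvector_iff (hk0 : 0 < k) (hk1 : k < 1) {x t : ℝ} {P Q : ℂ} :
    IsCnEigenvector k x t P Q ↔ P ^ 2 + Q ^ 2 = (uCn k x t : ℂ) ∧
      P ^ 2 - Q ^ 2 = (uCnX k x t : ℂ) / (2 * lamI k) ∧
      4 * lamI k * P * Q = -Complex.I * (kap k : ℂ) - (uCn k x t : ℂ) ^ 2 := by
  have hl := lamI_ne_zero hk0
  constructor
  · intro h
    refine ⟨h.u.symm, ?_, by linear_combination h.W⟩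
    rw [h.ux]; field_simp
  · rintro ⟨h1, h2, h3⟩
    have hW := sq_add_kap_ne_zero hk0 hk1 (uCn k x t)
    have h4 : (uCn k x t : ℂ) ^ 2 + Complex.I * (kap k : ℂ) = -4 * lamI k * P * Q := by
      linear_combination h3
    refine ⟨h1.symm, ?_, h4, ?_, ?_⟩
    · rw [h2]; field_simp
    · rintro rfl; exact hW (by rw [h4]; ring)
    · rintro rfl; exact hW (by rw [h4]; ring)

lemma isCnEigenfunction_iff (hk0 : 0 < k) (hk1 : k < 1) : IsCnEigenfunction k φ₁ φ₂ ↔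
    IsCnLaxOn k Set.univ (lamI k) φ₁ φ₂ ∧
      ∀ x t, IsCnEigenvector k x t (φ₁ x t) (φ₂ x t) := by
  rw [IsCnEigenfunction, isLaxSolution_uCn_iff hk0 hk1]
  simp only [isCnEigenvector_iff hk0 hk1]

/-- The square of the first component of the eigenfunction. -/
def eigenSq (k ξ : ℝ) : ℂ := ((cnProfile k ξ : ℂ) + (cnProfileDeriv k ξ : ℂ) / (2 * lamI k)) / 2

/-- The square of the second component of the eigenfunction. -/
def eigenSq' (k ξ : ℝ) : ℂ := ((cnProfile k ξ : ℂ) - (cnProfileDeriv k ξ : ℂ) / (2 * lamI k)) / 2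

/-- The product of the components of the eigenfunction. -/
def eigenProd (k ξ : ℝ) : ℂ :=
  -((cnProfile k ξ : ℂ) ^ 2 + Complex.I * (kap k : ℂ)) / (4 * lamI k)

lemma eigenProd_ne_zero (hk0 : 0 < k) (hk1 : k < 1) (ξ : ℝ) : eigenProd k ξ ≠ 0 :=
  div_ne_zero (neg_ne_zero.mpr (sq_add_kap_ne_zero hk0 hk1 _))
    (mul_ne_zero (by norm_num) (lamI_ne_zero hk0))

lemma eigenSq_mul_eigenSq' (hk0 : 0 < k) (hk1 : k < 1) (ξ : ℝ) :
    eigenSq k ξ * eigenSq' k ξ = eigenProd k ξ ^ 2 := by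
  have hl := lamI_ne_zero hk0
  have h := uCnX_sq_complex hk0 hk1 ξ 0
  rw [uCnX_eq hk0.le hk1, uCn] at h
  simp only [mul_zero, sub_zero] at h
  rw [eigenSq, eigenSq', eigenProd]
  field_simp
  linear_combination 16 * h

lemma eigenSq_ne_zero (hk0 : 0 < k) (hk1 : k < 1) (ξ : ℝ) : eigenSq k ξ ≠ 0 := by
  intro h
  have := eigenSq_mul_eigenSq' hk0 hk1 ξ
  rw [h, zero_mul] at this
  exact pow_ne_zero 2 (eigenProd_ne_zero hk0 hk1 ξ) this.symm

/-- The logarithmic derivative of the first component of the eigenfunction. -/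
def eigenLogDeriv (k ξ : ℝ) : ℂ := lamI k + cnProfile k ξ * eigenProd k ξ / eigenSq k ξ

lemma hasDerivAt_eigenSq (hk0 : 0 < k) (hk1 : k < 1) (ξ : ℝ) :
    HasDerivAt (eigenSq k) (2 * eigenLogDeriv k ξ * eigenSq k ξ) ξ := by
  have hl := lamI_ne_zero hk0
  have hF := eigenSq_ne_zero hk0 hk1 ξ
  have h1 := (hasDerivAt_cnProfile hk0.le hk1 ξ).ofReal_comp
  have h2 := (hasDerivAt_cnProfileDeriv hk0.le hk1 ξ).ofReal_comp
  refine ((h1.add (h2.div_const (2 * lamI k))).div_const 2).congr_deriv ?_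
  have h3 : 2 * eigenLogDeriv k ξ * eigenSq k ξ =
      2 * lamI k * eigenSq k ξ + 2 * cnProfile k ξ * eigenProd k ξ := by
    rw [eigenLogDeriv]; field_simp
  rw [h3, eigenSq, eigenProd]
  push_cast
  rw [cnSpeed_eq hk0 hk1]
  field_simp
  ring

lemma continuous_eigenLogDeriv (hk0 : 0 < k) (hk1 : k < 1) : Continuous (eigenLogDeriv k) := by
  have h1 : Continuous (cnProfile k) := (contDiff_cnProfile hk0.le hk1).continuous
  have h2 : Continuous (eigenSq k) := continuous_iff_continuousAt.mpr fun ξ =>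
    (hasDerivAt_eigenSq hk0 hk1 ξ).continuousAt
  have h3 : Continuous (eigenProd k) := by
    unfold eigenProd
    fun_prop
  unfold eigenLogDeriv
  exact continuous_const.add (((Complex.continuous_ofReal.comp h1).mul h3).div h2
    (eigenSq_ne_zero hk0 hk1))

/-- A smooth square root of `eigenSq`. -/
lemma exists_eigenRoot (hk0 : 0 < k) (hk1 : k < 1) : ∃ f : ℝ → ℂ,
    (∀ ξ, f ξ ^ 2 = eigenSq k ξ) ∧ ∀ ξ, HasDerivAt f (eigenLogDeriv k ξ * f ξ) ξ := by
  obtain ⟨a, ha⟩ := IsAlgClosed.exists_pow_nat_eq (eigenSq k 0) two_pos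
  -- Exponentiating the integrated logarithmic derivative avoids choosing a branch of the root. The
  -- ratio `f² / eigenSq` then has zero derivative and equals 1 at the origin.
  set f : ℝ → ℂ := fun ξ => a * Complex.exp (∫ y in (0 : ℝ)..ξ, eigenLogDeriv k y) with hf
  have hd : ∀ ξ, HasDerivAt f (eigenLogDeriv k ξ * f ξ) ξ := by
    intro ξ
    have h := ((continuous_eigenLogDeriv hk0 hk1).integral_hasStrictDerivAt 0 ξ).hasDerivAt
    refine (h.cexp.const_mul a).congr_deriv ?_
    simp only [hf]; ring
  refine ⟨f, fun ξ => ?_, hd⟩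
  have h0 : ∀ ξ, HasDerivAt (fun y => f y ^ 2 / eigenSq k y) 0 ξ := by
    intro ξ
    refine (((hd ξ).pow 2).div (hasDerivAt_eigenSq hk0 hk1 ξ)
      (eigenSq_ne_zero hk0 hk1 ξ)).congr_deriv ?_
    simp only [Pi.pow_apply]
    push_cast
    ring
  have hc := is_const_of_deriv_eq_zero (fun ξ => (h0 ξ).differentiableAt)
    (fun ξ => (h0 ξ).deriv) ξ 0
  have h1 : f 0 ^ 2 = eigenSq k 0 := by simp [hf, ha]
  simp only [h1, div_self (eigenSq_ne_zero hk0 hk1 0)] at hc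
  exact (div_eq_one_iff_eq (eigenSq_ne_zero hk0 hk1 ξ)).mp hc

lemma hasDerivAt_eigenProd (hk0 : 0 < k) (hk1 : k < 1) (ξ : ℝ) :
    HasDerivAt (eigenProd k) (-(cnProfile k ξ * cnProfileDeriv k ξ : ℂ) / (2 * lamI k)) ξ := by
  have hl := lamI_ne_zero hk0
  have h1 := (hasDerivAt_cnProfile hk0.le hk1 ξ).ofReal_comp
  refine ((((h1.pow 2).add_const _).neg).div_const (4 * lamI k)).congr_deriv ?_
  field_simp
  push_cast
  ring

theorem exists_isCnEigenfunction (hk0 : 0 < k) (hk1 : k < 1) :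
    ∃ φ₁ φ₂ : ℝ → ℝ → ℂ, IsCnEigenfunction k φ₁ φ₂ := by
  obtain ⟨f, hf, hd⟩ := exists_eigenRoot hk0 hk1
  have hl := lamI_ne_zero hk0
  have hf0 : ∀ ξ, f ξ ≠ 0 := fun ξ h => eigenSq_ne_zero hk0 hk1 ξ (by rw [← hf, h]; ring)
  -- The second component is forced by the product; taking an independent root of `eigenSq'` would
  -- leave its sign undetermined.
  set g : ℝ → ℂ := fun ξ => eigenProd k ξ / f ξ with hg
  have hfg : ∀ ξ, f ξ * g ξ = eigenProd k ξ := fun ξ => by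
    have := hf0 ξ
    simp only [hg]; field_simp
  have hg2 : ∀ ξ, g ξ ^ 2 = eigenSq' k ξ := fun ξ => by
    have h1 := eigenSq_mul_eigenSq' hk0 hk1 ξ
    rw [← hfg, ← hf, mul_pow] at h1
    exact (mul_left_cancel₀ (pow_ne_zero 2 (hf0 ξ)) h1).symm
  have hdf : ∀ ξ, HasDerivAt f (lamI k * f ξ + cnProfile k ξ * g ξ) ξ := by
    intro ξ
    refine (hd ξ).congr_deriv ?_
    have := hf0 ξ
    rw [eigenLogDeriv, ← hf, ← hfg]
    field_simp
  have hdg : ∀ ξ, HasDerivAt g (-cnProfile k ξ * f ξ - lamI k * g ξ) ξ := by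
    intro ξ
    refine ((hasDerivAt_eigenProd hk0 hk1 ξ).div (hdf ξ) (hf0 ξ)).congr_deriv ?_
    have h1 := hf0 ξ
    have h2 : (cnProfileDeriv k ξ : ℂ) = 2 * lamI k * (f ξ ^ 2 - g ξ ^ 2) := by
      rw [hf, hg2, eigenSq, eigenSq']; field_simp; ring
    rw [← hfg, h2]
    field_simp
    ring
  have hvec : ∀ x t, IsCnEigenvector k x t (f (x - cnSpeed k * t)) (g (x - cnSpeed k * t)) := by
    intro x t
    rw [isCnEigenvector_iff hk0 hk1, uCnX_eq hk0.le hk1, uCn]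
    have h1 : 4 * lamI k * f (x - cnSpeed k * t) * g (x - cnSpeed k * t) =
        4 * lamI k * eigenProd k (x - cnSpeed k * t) := by rw [← hfg]; ring
    rw [h1, hf, hg2, eigenSq, eigenSq', eigenProd]
    refine ⟨by ring, by ring, ?_⟩
    field_simp
    ring
  have htime : ∀ (h : ℝ → ℂ) (h' : ℂ) (x t : ℝ), HasDerivAt h h' (x - cnSpeed k * t) →
      HasDerivAt (fun s => h (x - cnSpeed k * s)) (-cnSpeed k * h') t := by
    intro h h' x t hh
    have hs : HasDerivAt (fun s : ℝ => x - cnSpeed k * s) (-cnSpeed k) t := by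
      simpa using ((hasDerivAt_id t).const_mul (cnSpeed k)).const_sub x
    refine (hh.scomp t hs).congr_deriv ?_
    simp
  refine ⟨fun x t => f (x - cnSpeed k * t), fun x t => g (x - cnSpeed k * t),
    (isCnEigenfunction_iff hk0 hk1).mpr ⟨⟨fun x t _ => ?_, fun x t _ => ?_, fun x t _ => ?_,
      fun x t _ => ?_⟩, hvec⟩⟩
  · exact (hdf _).comp_sub_const x _
  · exact (hdg _).comp_sub_const x _
  · refine (htime f _ x t (hdf _)).congr_deriv ?_
    have hv := hvec x t
    change -(cnSpeed k : ℂ) * (_ + (uCn k x t : ℂ) * _) = _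
    rw [hv.speed hk0 hk1, hv.ux, hv.u]
    ring
  · refine (htime g _ x t (hdg _)).congr_deriv ?_
    have hv := hvec x t
    change -(cnSpeed k : ℂ) * (-(uCn k x t : ℂ) * _ - _) = _
    rw [hv.speed hk0 hk1, hv.ux, hv.u]
    ring

/-- Reduction of order: inserting the form of `ψ` into the Lax pair leaves only the equations for
`θ_x` and `θ_t`, which are `hasDerivAt_thetaCn_x` and `hasDerivAt_thetaCn_t`. -/
lemma isCnLaxOn_psi (hk0 : 0 < k) (hk1 : k < 1) (h : IsCnLaxOn k Set.univ (lamI k) φ₁ φ₂)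
    (hv : ∀ x t, IsCnEigenvector k x t (φ₁ x t) (φ₂ x t)) :
    IsCnLaxOn k Set.univ (lamI k) (psi₁ k φ₂) (psi₂ k φ₁) where
  px x t hx := by
    have hl := lamI_ne_zero hk0
    have hP := (hv x t).P_ne
    have hQ := (hv x t).Q_ne
    refine (((hasDerivAt_thetaCn_x hk0 hk1 x t).sub_const 1).div (h.qx x t hx) hQ).congr_deriv ?_
    rw [psi₁, psi₂, (hv x t).W, (hv x t).ux, (hv x t).u]
    field_simp
    ring
  qx x t hx := by
    have hl := lamI_ne_zero hk0
    have hP := (hv x t).P_ne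
    have hQ := (hv x t).Q_ne
    refine (((hasDerivAt_thetaCn_x hk0 hk1 x t).add_const 1).div (h.px x t hx) hP).congr_deriv ?_
    rw [psi₁, psi₂, (hv x t).W, (hv x t).ux, (hv x t).u]
    field_simp
    ring
  pt x t hx := by
    have hl := lamI_ne_zero hk0
    have hP := (hv x t).P_ne
    have hQ := (hv x t).Q_ne
    refine (((hasDerivAt_thetaCn_t hk0 hk1 x t).sub_const 1).div (h.qt x t hx) hQ).congr_deriv ?_
    rw [psi₁, psi₂, (hv x t).W, (hv x t).speed hk0 hk1, (hv x t).ux, (hv x t).u]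
    field_simp
    ring
  qt x t hx := by
    have hl := lamI_ne_zero hk0
    have hP := (hv x t).P_ne
    have hQ := (hv x t).Q_ne
    refine (((hasDerivAt_thetaCn_t hk0 hk1 x t).add_const 1).div (h.pt x t hx) hP).congr_deriv ?_
    rw [psi₁, psi₂, (hv x t).W, (hv x t).speed hk0 hk1, (hv x t).ux, (hv x t).u]
    field_simp
    ring

lemma wronskian_psi (hv : ∀ x t, IsCnEigenvector k x t (φ₁ x t) (φ₂ x t)) (x t : ℝ) :
    φ₁ x t * psi₂ k φ₁ x t - φ₂ x t * psi₁ k φ₂ x t = 2 := by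
  have hP := (hv x t).P_ne
  have hQ := (hv x t).Q_ne
  rw [psi₁, psi₂]
  field_simp
  ring

/-- The squares and the product of the components have period `T`. Hence `φ₁(x + T)/φ₁(x)` has
square 1 and zero derivative: it is a constant sign, which disappears after two periods. -/
lemma periodic_eigenfunction (hk0 : 0 < k) (hk1 : k < 1)
    (h : IsCnLaxOn k Set.univ (lamI k) φ₁ φ₂)
    (hv : ∀ x t, IsCnEigenvector k x t (φ₁ x t) (φ₂ x t)) (t : ℝ) :
    Function.Periodic (fun x => φ₁ x t) (2 * Jacobi.period k) ∧
      Function.Periodic (fun x => φ₂ x t) (2 * Jacobi.period k) := by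
  have hl := lamI_ne_zero hk0
  set T := Jacobi.period k with hT
  have hu : ∀ x, uCn k (x + T) t = uCn k x t := fun x => by
    rw [uCn, add_sub_right_comm, periodic_cnProfile hk0.le hk1, uCn]
  have hux : ∀ x, uCnX k (x + T) t = uCnX k x t := fun x => by
    rw [uCnX_eq hk0.le hk1, add_sub_right_comm, periodic_cnProfileDeriv hk0.le hk1,
      uCnX_eq hk0.le hk1]
  have hsq : ∀ x, φ₁ (x + T) t ^ 2 = φ₁ x t ^ 2 := fun x => by
    have h1 := (hv x t).u
    have h2 := (hv x t).ux
    have h3 := (hv (x + T) t).u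
    have h4 := (hv (x + T) t).ux
    rw [hu, h1] at h3
    rw [hux, h2] at h4
    have h5 := mul_left_cancel₀ (mul_ne_zero two_ne_zero hl) h4
    linear_combination -(h3 + h5) / 2
  have hprod : ∀ x, φ₁ (x + T) t * φ₂ (x + T) t = φ₁ x t * φ₂ x t := fun x => by
    have h1 := (hv x t).W
    have h3 := (hv (x + T) t).W
    rw [hu, h1] at h3
    have : (4 * lamI k) * (φ₁ (x + T) t * φ₂ (x + T) t) = (4 * lamI k) * (φ₁ x t * φ₂ x t) := by
      linear_combination h3
    exact mul_left_cancel₀ (mul_ne_zero (by norm_num) hl) this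
  have h0 : ∀ x, HasDerivAt (fun y => φ₁ (y + T) t / φ₁ y t) 0 x := by
    intro x
    have h1 := (h.px (x + T) t trivial).comp_add_const x T
    refine (h1.div (h.px x t trivial) (hv x t).P_ne).congr_deriv ?_
    have hP := (hv x t).P_ne
    rw [hu]
    have h2 : φ₂ (x + T) t * φ₁ x t - φ₁ (x + T) t * φ₂ x t = 0 := by
      refine (mul_eq_zero.mp ?_).resolve_left hP
      linear_combination φ₁ (x + T) t * hprod x - φ₂ (x + T) t * hsq x
    rw [div_eq_zero_iff]
    left
    linear_combination (uCn k x t : ℂ) * h2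
  have hper : ∀ x, φ₁ (x + 2 * T) t = φ₁ x t := by
    intro x
    have hc := is_const_of_deriv_eq_zero (fun ξ => (h0 ξ).differentiableAt)
      (fun ξ => (h0 ξ).deriv) (x + T) x
    have h1 := (hv x t).P_ne
    have h2 := (hv (x + T) t).P_ne
    rw [div_eq_div_iff h2 h1, add_assoc, ← two_mul] at hc
    refine mul_right_cancel₀ h1 (hc.trans ?_)
    rw [← pow_two, ← pow_two, hsq]
  refine ⟨hper, fun x => ?_⟩
  have h1 := hprod (x + T)
  rw [hprod x, add_assoc, ← two_mul, hper] at h1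
  exact mul_left_cancel₀ (hv x t).P_ne h1

/-- Continuous periodic functions are bounded, while `θ` is unbounded along each line of constant
`t`. It applies to `ψ₁φ₂ = θ - 1` and `ψ₂φ₁ = θ + 1`. -/
lemma not_periodic_of_mul_eq_thetaCn (hk0 : 0 < k) (hk1 : k < 1) {f g : ℝ → ℂ} {t a L M : ℝ}
    (hL : L ≠ 0) (hM : M ≠ 0) (hf : Continuous f) (hg : Continuous g)
    (hgM : Function.Periodic g M) (hfg : ∀ x, f x * g x = thetaCn k x t + a) :
    ¬ Function.Periodic f L := by
  intro hfL
  obtain ⟨A, hA⟩ := (hfL.isBounded_of_continuous hL hf).exists_norm_le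
  obtain ⟨B, hB⟩ := (hgM.isBounded_of_continuous hM hg).exists_norm_le
  have hlim : Filter.Tendsto (fun x : ℝ => ‖thetaCn k x t‖) Filter.atTop Filter.atTop := by
    have hp : Filter.Tendsto (fun x : ℝ => ((x, t) : ℝ × ℝ)) Filter.atTop
        (Filter.comap (fun p : ℝ × ℝ => |p.1| + |p.2|) Filter.atTop) := by
      rw [Filter.tendsto_comap_iff]
      exact Filter.tendsto_atTop_add_const_right _ |t| Filter.tendsto_abs_atTop_atTop
    have h := (tendsto_norm_thetaCn hk0 hk1).comp hp
    simp only [Function.comp_def] at h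
    exact h
  obtain ⟨x, hx⟩ := (hlim.eventually (Filter.eventually_gt_atTop (A * B + |a|))).exists
  have h1 : ‖thetaCn k x t‖ ≤ ‖f x * g x‖ + ‖(a : ℂ)‖ := by
    have := norm_sub_le (f x * g x) (a : ℂ)
    rwa [hfg, add_sub_cancel_right, ← hfg] at this
  rw [norm_mul, Complex.norm_real, Real.norm_eq_abs] at h1
  have h2 := hA _ ⟨x, rfl⟩
  have h3 := hB _ ⟨x, rfl⟩
  have h4 := mul_le_mul h2 h3 (norm_nonneg _) ((norm_nonneg _).trans h2)
  linarith

end Eigenfunctions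

/-! ### The rogue wave as a two-fold Darboux transformation -/

section Rogue

variable {k : ℝ} {φ₁ φ₂ : ℝ → ℝ → ℂ} {x t : ℝ}

/-- The function `(1 + θ²) u - λ⁻¹ θ u_x`, proportional to `ψ₁² + ψ₂²`. -/
def psiSum (k x t : ℝ) : ℂ :=
  (1 + thetaCn k x t ^ 2) * uCn k x t - (lamI k)⁻¹ * thetaCn k x t * uCnX k x t

/-- The function `(1 + θ²) (2λ)⁻¹ u_x - 2 θ u`, proportional to `ψ₁² - ψ₂²`. -/
def psiDiff (k x t : ℝ) : ℂ :=
  (1 + thetaCn k x t ^ 2) * (2 * lamI k)⁻¹ * uCnX k x t - 2 * thetaCn k x t * uCn k x t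

lemma G₁_eq (k x t : ℝ) : G₁ k x t = 4 * kap k *
    (((uCn k x t : ℂ) ^ 2 + Complex.I * (kap k : ℂ)) * (1 - thetaCn k x t ^ 2) *
      starRingEnd ℂ (psiSum k x t)).im := by
  simp [G₁, psiSum]

lemma G₂_eq (k x t : ℝ) : G₂ k x t = (1 - 2 * k ^ 2) * ‖psiSum k x t‖ ^ 2
    + ‖1 - thetaCn k x t ^ 2‖ ^ 2 * (uCn k x t ^ 4 + k ^ 2 * (1 - k ^ 2))
    + ‖psiDiff k x t‖ ^ 2 := rfl

lemma norm_sq_add_kap (hk0 : 0 < k) (hk1 : k < 1) (v : ℝ) :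
    ‖(v : ℂ) ^ 2 + Complex.I * (kap k : ℂ)‖ ^ 2 = v ^ 4 + k ^ 2 * (1 - k ^ 2) := by
  rw [← Complex.normSq_eq_norm_sq, Complex.normSq_apply, ← Complex.ofReal_pow,
    ← kap_sq hk0 hk1]
  simp [-Complex.ofReal_pow]
  ring

/-- This is `(ψ₁² + ψ₂²)² - (ψ₁² - ψ₂²)² = 4ψ₁²ψ₂²` after clearing denominators. -/
lemma psiSum_sq_sub_psiDiff_sq (hk0 : 0 < k) (hk1 : k < 1) (x t : ℝ) :
    (2 * lamI k) ^ 2 * (psiSum k x t ^ 2 - psiDiff k x t ^ 2) =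
      ((1 - thetaCn k x t ^ 2) * ((uCn k x t : ℂ) ^ 2 + Complex.I * (kap k : ℂ))) ^ 2 := by
  have hl := lamI_ne_zero hk0
  rw [mul_pow _ (_ + _), ← uCnX_sq_complex hk0 hk1, psiSum, psiDiff]
  field_simp
  ring

/-- Let `A` and `B` be `psiSum` and `psiDiff`. As `|2λ_I| = 1`, the identity above gives `|A|² ≤
|B|² + |(1 - θ²)W|²`, so `G₂ ≥ 2(1 - k²)|A|²`. If `A = 0` then `G₂ ≥ |B|²`, and `A = B = 0` would
force `W = 0`. -/
theorem G₂_pos (hk0 : 0 < k) (hk1 : k < 1) (x t : ℝ) : 0 < G₂ k x t := by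
  have hW := sq_add_kap_ne_zero hk0 hk1 (uCn k x t)
  have h1 := congrArg norm (psiSum_sq_sub_psiDiff_sq hk0 hk1 x t)
  rw [norm_mul, norm_pow, norm_mul, norm_lamI hk0 hk1, RCLike.norm_ofNat, norm_pow, norm_mul] at h1
  have h2 : ‖psiSum k x t‖ ^ 2 ≤ ‖psiDiff k x t‖ ^ 2 +
      (‖1 - thetaCn k x t ^ 2‖ * ‖(uCn k x t : ℂ) ^ 2 + Complex.I * (kap k : ℂ)‖) ^ 2 := by
    rw [← h1]
    have := norm_add_le (psiDiff k x t ^ 2) (psiSum k x t ^ 2 - psiDiff k x t ^ 2)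
    rw [add_sub_cancel, norm_pow, norm_pow] at this
    linarith
  rw [G₂_eq, ← norm_sq_add_kap hk0 hk1]
  by_cases hA : psiSum k x t = 0
  · by_cases hB : psiDiff k x t = 0
    · exfalso
      have h3 := psiSum_sq_sub_psiDiff_sq hk0 hk1 x t
      rw [hA, hB] at h3
      have h4 : 1 - thetaCn k x t ^ 2 = 0 := by
        have : ((1 - thetaCn k x t ^ 2) *
          ((uCn k x t : ℂ) ^ 2 + Complex.I * (kap k : ℂ))) ^ 2 = 0 := by rw [← h3]; ring
        exact (mul_eq_zero.mp (pow_eq_zero_iff two_ne_zero |>.mp this)).resolve_right hW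
      have hl := lamI_ne_zero hk0
      have h5 := uCnX_sq_complex hk0 hk1 x t
      -- This is `A = 0` at `θ² = 1`; squaring it gives `4λ²u² = u_x²`, that is `W² = 0`.
      have h6 : 2 * lamI k * (uCn k x t : ℂ) = thetaCn k x t * uCnX k x t := by
        have h7 : lamI k * psiSum k x t = 0 := by rw [hA, mul_zero]
        rw [psiSum] at h7
        field_simp at h7
        linear_combination h7 + lamI k * uCn k x t * h4
      refine pow_ne_zero 2 hW ?_
      rw [← h5]
      linear_combination
        (2 * lamI k * (uCn k x t : ℂ) + thetaCn k x t * uCnX k x t) * h6 - uCnX k x t ^ 2 * h4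
    · rw [hA, norm_zero]
      have := norm_pos_iff.mpr hB
      have h0 : (1 - 2 * k ^ 2) * (0 : ℝ) ^ 2 = 0 := by ring
      rw [h0, zero_add]
      positivity
  · have := norm_pos_iff.mpr hA
    have h3 : 0 < (1 - k ^ 2) * ‖psiSum k x t‖ ^ 2 := mul_pos (by nlinarith) (by positivity)
    rw [mul_pow] at h2
    linarith

lemma psi_sq_add_sq (h : IsCnEigenvector k x t (φ₁ x t) (φ₂ x t)) (hk0 : 0 < k) :
    psi₁ k φ₂ x t ^ 2 + psi₂ k φ₁ x t ^ 2 = psiSum k x t / (φ₁ x t * φ₂ x t) ^ 2 := by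
  have hl := lamI_ne_zero hk0
  have hP := h.P_ne
  have hQ := h.Q_ne
  rw [psi₁, psi₂, psiSum, h.u, h.ux]
  field_simp
  ring

lemma psi_sq_sub_sq (h : IsCnEigenvector k x t (φ₁ x t) (φ₂ x t)) (hk0 : 0 < k) :
    psi₁ k φ₂ x t ^ 2 - psi₂ k φ₁ x t ^ 2 = psiDiff k x t / (φ₁ x t * φ₂ x t) ^ 2 := by
  have hl := lamI_ne_zero hk0
  have hP := h.P_ne
  have hQ := h.Q_ne
  rw [psi₁, psi₂, psiDiff, h.u, h.ux]
  field_simp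
  ring

lemma psi_mul (h : IsCnEigenvector k x t (φ₁ x t) (φ₂ x t)) :
    psi₁ k φ₂ x t * psi₂ k φ₁ x t = (thetaCn k x t ^ 2 - 1) / (φ₁ x t * φ₂ x t) := by
  have hP := h.P_ne
  have hQ := h.Q_ne
  rw [psi₁, psi₂]
  field_simp
  ring

lemma lamI_sq_add_conj_sq (hk0 : 0 < k) (hk1 : k < 1) :
    lamI k ^ 2 + starRingEnd ℂ (lamI k) ^ 2 = (2 * (k : ℂ) ^ 2 - 1) / 2 := by
  have h1 := four_mul_lamI_sq hk0 hk1
  have h2 := congrArg (starRingEnd ℂ) h1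
  simp only [cnSpeed] at h1 h2
  simp only [map_mul, map_pow, map_add, map_ofNat, Complex.conj_ofReal, Complex.conj_I] at h2
  push_cast at h1 h2
  linear_combination (h1 + h2) / 4

lemma lamI_sq_sub_conj_sq (hk0 : 0 < k) (hk1 : k < 1) :
    lamI k ^ 2 - starRingEnd ℂ (lamI k) ^ 2 = Complex.I * kap k := by
  have h1 := four_mul_lamI_sq hk0 hk1
  have h2 := congrArg (starRingEnd ℂ) h1
  simp only [map_mul, map_pow, map_add, map_ofNat, Complex.conj_ofReal, Complex.conj_I] at h2
  linear_combination (h1 - h2) / 4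

/-- The denominator of the two-fold Darboux transformation is `-G₂ / (2 |φ₁ φ₂|⁴)`. -/
lemma twoFoldDenom_psi (hk0 : 0 < k) (hk1 : k < 1)
    (h : IsCnEigenvector k x t (φ₁ x t) (φ₂ x t)) :
    twoFoldDenom (lamI k) (starRingEnd ℂ (lamI k)) (psi₁ k φ₂ x t) (psi₂ k φ₁ x t)
        (starRingEnd ℂ (psi₁ k φ₂ x t)) (starRingEnd ℂ (psi₂ k φ₁ x t)) =
      -(G₂ k x t : ℂ) /
        (2 * ((φ₁ x t * φ₂ x t) ^ 2 * starRingEnd ℂ ((φ₁ x t * φ₂ x t) ^ 2))) := by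
  have hD : φ₁ x t * φ₂ x t ≠ 0 := mul_ne_zero h.P_ne h.Q_ne
  have hD' : starRingEnd ℂ (φ₁ x t * φ₂ x t) ≠ 0 := (map_ne_zero _).mpr hD
  have ha := psi_sq_add_sq h hk0
  have hb := psi_sq_sub_sq h hk0
  have hm := psi_mul h
  have ha' := congrArg (starRingEnd ℂ) ha
  have hb' := congrArg (starRingEnd ℂ) hb
  have hm' := congrArg (starRingEnd ℂ) hm
  rw [map_add, map_pow, map_pow, map_div₀, map_pow] at ha'
  rw [map_sub, map_pow, map_pow, map_div₀, map_pow] at hb'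
  rw [map_mul, map_div₀, map_sub, map_pow, map_one] at hm'
  have hW : 4 * ((φ₁ x t * φ₂ x t) * starRingEnd ℂ (φ₁ x t * φ₂ x t)) =
      ((uCn k x t : ℂ) ^ 4 + (k : ℂ) ^ 2 * (1 - (k : ℂ) ^ 2)) := by
    have h1 := norm_sq_add_kap hk0 hk1 (uCn k x t)
    have h2 := congrArg (fun r : ℝ => (r : ℂ)) h1
    push_cast at h2
    rw [← h2, h.W, ← Complex.mul_conj']
    simp only [map_mul, map_neg, map_ofNat]
    linear_combination -4 * (φ₁ x t * φ₂ x t * (starRingEnd ℂ (φ₁ x t) * starRingEnd ℂ (φ₂ x t))) *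
      four_mul_lamI_mul_conj hk0 hk1
  have hG : (G₂ k x t : ℂ) = (1 - 2 * (k : ℂ) ^ 2) *
        (psiSum k x t * starRingEnd ℂ (psiSum k x t)) +
      ((1 - thetaCn k x t ^ 2) * (1 - starRingEnd ℂ (thetaCn k x t) ^ 2)) *
        (4 * ((φ₁ x t * φ₂ x t) * starRingEnd ℂ (φ₁ x t * φ₂ x t))) +
      psiDiff k x t * starRingEnd ℂ (psiDiff k x t) := by
    have h3 : 1 - starRingEnd ℂ (thetaCn k x t) ^ 2 = starRingEnd ℂ (1 - thetaCn k x t ^ 2) := by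
      simp
    rw [h3, hW, Complex.mul_conj', Complex.mul_conj', Complex.mul_conj', G₂_eq]
    push_cast
    ring
  -- Regrouped so that only `p² ± q²`, `pq` and `4λλ̄ = 1` occur, all of which are known.
  have hsplit : ∀ p q p' q' : ℂ, twoFoldDenom (lamI k) (starRingEnd ℂ (lamI k)) p q p' q' =
      (lamI k ^ 2 + starRingEnd ℂ (lamI k) ^ 2) * ((p ^ 2 + q ^ 2) * (p' ^ 2 + q' ^ 2)) -
      (4 * lamI k * starRingEnd ℂ (lamI k)) / 2 * (4 * ((p * q) * (p' * q')) +
        (p ^ 2 - q ^ 2) * (p' ^ 2 - q' ^ 2)) := by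
    intro p q p' q'
    rw [twoFoldDenom]; ring
  rw [hsplit, ha, hb, hm, ha', hb', hm', four_mul_lamI_mul_conj hk0 hk1,
    lamI_sq_add_conj_sq hk0 hk1, hG, map_pow]
  generalize φ₁ x t * φ₂ x t = d at *
  generalize starRingEnd ℂ d = d' at *
  field_simp
  ring

lemma twoFoldDenom_psi_ne_zero (hk0 : 0 < k) (hk1 : k < 1)
    (h : IsCnEigenvector k x t (φ₁ x t) (φ₂ x t)) :
    twoFoldDenom (lamI k) (starRingEnd ℂ (lamI k)) (psi₁ k φ₂ x t) (psi₂ k φ₁ x t)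
        (starRingEnd ℂ (psi₁ k φ₂ x t)) (starRingEnd ℂ (psi₂ k φ₁ x t)) ≠ 0 := by
  have hD : φ₁ x t * φ₂ x t ≠ 0 := mul_ne_zero h.P_ne h.Q_ne
  rw [twoFoldDenom_psi hk0 hk1 h]
  refine div_ne_zero (neg_ne_zero.mpr ?_) (mul_ne_zero two_ne_zero
    (mul_ne_zero (pow_ne_zero 2 hD) ((map_ne_zero _).mpr (pow_ne_zero 2 hD))))
  exact_mod_cast (G₂_pos hk0 hk1 x t).ne'

/-- Reality: the bracket in the numerator is a difference of complex conjugates and `λ_I² - λ̄_I² =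
iκ`, so both factors are imaginary; the denominator is real. -/
theorem twoFoldDarboux_psi (hk0 : 0 < k) (hk1 : k < 1)
    (h : IsCnEigenvector k x t (φ₁ x t) (φ₂ x t)) :
    twoFoldDarboux (uCn k x t) (lamI k) (starRingEnd ℂ (lamI k)) (psi₁ k φ₂ x t) (psi₂ k φ₁ x t)
        (starRingEnd ℂ (psi₁ k φ₂ x t)) (starRingEnd ℂ (psi₂ k φ₁ x t)) =
      (uCnRogue k x t : ℂ) := by
  have hl := lamI_ne_zero hk0
  have hl' : starRingEnd ℂ (lamI k) ≠ 0 := (map_ne_zero _).mpr hl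
  have hD : φ₁ x t * φ₂ x t ≠ 0 := mul_ne_zero h.P_ne h.Q_ne
  have hD' : starRingEnd ℂ (φ₁ x t * φ₂ x t) ≠ 0 := (map_ne_zero _).mpr hD
  have hG0 : (G₂ k x t : ℂ) ≠ 0 := by exact_mod_cast (G₂_pos hk0 hk1 x t).ne'
  have ha := psi_sq_add_sq h hk0
  have hm := psi_mul h
  have ha' := congrArg (starRingEnd ℂ) ha
  have hm' := congrArg (starRingEnd ℂ) hm
  rw [map_add, map_pow, map_pow, map_div₀, map_pow] at ha'
  rw [map_mul, map_div₀, map_sub, map_pow, map_one] at hm'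
  have hd : φ₁ x t * φ₂ x t = -((uCn k x t : ℂ) ^ 2 + Complex.I * (kap k : ℂ)) / (4 * lamI k) := by
    rw [h.W]; field_simp
  have hd' : starRingEnd ℂ (φ₁ x t * φ₂ x t) =
      -((uCn k x t : ℂ) ^ 2 - Complex.I * (kap k : ℂ)) / (4 * starRingEnd ℂ (lamI k)) := by
    rw [hd]
    simp only [map_div₀, map_neg, map_add, map_pow, map_mul, map_ofNat, Complex.conj_ofReal,
      Complex.conj_I]
    ring
  have hG1 : (G₁ k x t : ℂ) = -2 * Complex.I * kap k *
      (((uCn k x t : ℂ) ^ 2 + Complex.I * (kap k : ℂ)) * (1 - thetaCn k x t ^ 2) *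
        starRingEnd ℂ (psiSum k x t) -
      ((uCn k x t : ℂ) ^ 2 - Complex.I * (kap k : ℂ)) * (1 - starRingEnd ℂ (thetaCn k x t) ^ 2) *
        psiSum k x t) := by
    rw [G₁_eq]
    push_cast
    rw [Complex.im_eq_sub_conj]
    simp only [map_add, map_sub, map_pow, map_mul, map_one, Complex.conj_ofReal,
      Complex.conj_I, Complex.conj_conj]
    field_simp
    rw [Complex.I_sq]
    ring
  rw [twoFoldDarboux, twoFoldDenom_psi hk0 hk1 h, lamI_sq_sub_conj_sq hk0 hk1,
    mul_assoc (lamI k), mul_assoc (starRingEnd ℂ (lamI k)), ha, hm, ha', hm', uCnRogue]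
  push_cast
  rw [hG1, map_pow]
  congr 1
  have h1 : (uCn k x t : ℂ) ^ 2 + Complex.I * (kap k : ℂ) = -4 * lamI k * (φ₁ x t * φ₂ x t) := by
    rw [h.W]; ring
  have h2 : (uCn k x t : ℂ) ^ 2 - Complex.I * (kap k : ℂ) =
      -4 * starRingEnd ℂ (lamI k) * starRingEnd ℂ (φ₁ x t * φ₂ x t) := by
    rw [hd']; field_simp
  rw [h1, h2]
  generalize φ₁ x t * φ₂ x t = d at *
  generalize starRingEnd ℂ d = d' at *
  field_simp
  ring

end Rogue

/-! ### Smoothness and the mKdV equation -/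

section Solution

variable {k : ℝ} {φ₁ φ₂ : ℝ → ℝ → ℂ}

lemma contDiff_uCn_complex (hk0 : 0 < k) (hk1 : k < 1) :
    ContDiff ℝ ∞ (fun p : ℝ × ℝ => (uCn k p.1 p.2 : ℂ)) :=
  Complex.ofRealCLM.contDiff.comp (contDiff_uCn hk0.le hk1)

lemma contDiff_uCnX_complex (hk0 : 0 < k) (hk1 : k < 1) :
    ContDiff ℝ ∞ (fun p : ℝ × ℝ => (uCnX k p.1 p.2 : ℂ)) :=
  Complex.ofRealCLM.contDiff.comp (contDiff_uCnX hk0.le hk1)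

lemma contDiff_psiSum (hk0 : 0 < k) (hk1 : k < 1) :
    ContDiff ℝ ∞ (fun p : ℝ × ℝ => psiSum k p.1 p.2) :=
  ((contDiff_const.add ((contDiff_thetaCn hk0 hk1).pow 2)).mul
    (contDiff_uCn_complex hk0 hk1)).sub
    ((contDiff_const.mul (contDiff_thetaCn hk0 hk1)).mul (contDiff_uCnX_complex hk0 hk1))

lemma contDiff_psiDiff (hk0 : 0 < k) (hk1 : k < 1) :
    ContDiff ℝ ∞ (fun p : ℝ × ℝ => psiDiff k p.1 p.2) :=
  (((contDiff_const.add ((contDiff_thetaCn hk0 hk1).pow 2)).mul contDiff_const).mul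
    (contDiff_uCnX_complex hk0 hk1)).sub
    ((contDiff_const.mul (contDiff_thetaCn hk0 hk1)).mul (contDiff_uCn_complex hk0 hk1))

lemma contDiff_G₁ (hk0 : 0 < k) (hk1 : k < 1) :
    ContDiff ℝ ∞ (fun p : ℝ × ℝ => G₁ k p.1 p.2) := by
  simp only [G₁_eq]
  have h1 : ContDiff ℝ ∞ (fun p : ℝ × ℝ => starRingEnd ℂ (psiSum k p.1 p.2)) :=
    Complex.conjCLE.contDiff.comp (contDiff_psiSum hk0 hk1)
  exact contDiff_const.mul (Complex.imCLM.contDiff.comp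
    (((((contDiff_uCn_complex hk0 hk1).pow 2).add contDiff_const).mul
      (contDiff_const.sub ((contDiff_thetaCn hk0 hk1).pow 2))).mul h1))

lemma contDiff_G₂ (hk0 : 0 < k) (hk1 : k < 1) :
    ContDiff ℝ ∞ (fun p : ℝ × ℝ => G₂ k p.1 p.2) := by
  simp only [G₂_eq]
  exact ((contDiff_const.mul ((contDiff_psiSum hk0 hk1).norm_sq ℝ)).add
    (((contDiff_const.sub ((contDiff_thetaCn hk0 hk1).pow 2)).norm_sq ℝ).mul
      (((contDiff_uCn hk0.le hk1).pow 4).add contDiff_const))).add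
    ((contDiff_psiDiff hk0 hk1).norm_sq ℝ)

lemma contDiff_uCnRogue (hk0 : 0 < k) (hk1 : k < 1) :
    ContDiff ℝ ∞ (fun p : ℝ × ℝ => uCnRogue k p.1 p.2) :=
  (contDiff_uCn hk0.le hk1).add ((contDiff_G₁ hk0 hk1).div (contDiff_G₂ hk0 hk1)
    fun p => (G₂_pos hk0 hk1 p.1 p.2).ne')

/-- The derivative of a real function is the derivative of its complexification. -/
lemma hasDerivAt_of_ofReal {f : ℝ → ℝ} {z : ℂ} {x : ℝ}
    (h : HasDerivAt (fun y => (f y : ℂ)) z x) : z = ((deriv f x : ℝ) : ℂ) := by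
  have h1 : HasDerivAt f z.re x := by
    have := Complex.reCLM.hasFDerivAt.comp_hasDerivAt x h
    simpa [Function.comp_def] using this
  rw [h1.deriv]
  exact h.unique h1.ofReal_comp

/-- A complex solution of the mKdV equation with real values is a real solution. -/
lemma IsSolOn.real_eqn {Ω : Set (ℝ × ℝ)} {v v₁ v₂ v₃ vt : ℝ → ℝ → ℂ} {r : ℝ → ℝ → ℝ}
    (hv : IsSolOn Ω v v₁ v₂ v₃ vt) (hΩ : IsOpen Ω)
    (hr : ∀ x t, (x, t) ∈ Ω → v x t = (r x t : ℂ)) {x t : ℝ} (hx : (x, t) ∈ Ω) :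
    deriv (fun s => r x s) t + 6 * r x t ^ 2 * deriv (fun y => r y t) x
      + iteratedDeriv 3 (fun y => r y t) x = 0 := by
  have hxo : ∀ y, (y, t) ∈ Ω → ∀ᶠ z in nhds y, (z, t) ∈ Ω := fun y hy =>
    (Continuous.prodMk_left t).continuousAt.eventually (hΩ.mem_nhds hy)
  have hto : ∀ᶠ s in nhds t, (x, s) ∈ Ω :=
    (Continuous.prodMk_right x).continuousAt.eventually (hΩ.mem_nhds hx)
  have h1 : ∀ y, (y, t) ∈ Ω → v₁ y t = ((deriv (fun y => r y t) y : ℝ) : ℂ) := fun y hy =>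
    hasDerivAt_of_ofReal ((hv.d₁ y t hy).congr_of_eventuallyEq
      ((hxo y hy).mono fun z hz => (hr z t hz).symm))
  have h2 : ∀ y, (y, t) ∈ Ω → v₂ y t = ((deriv (deriv fun y => r y t) y : ℝ) : ℂ) := fun y hy =>
    hasDerivAt_of_ofReal ((hv.d₂ y t hy).congr_of_eventuallyEq
      ((hxo y hy).mono fun z hz => (h1 z hz).symm))
  have h3 : v₃ x t = ((deriv (deriv (deriv fun y => r y t)) x : ℝ) : ℂ) :=
    hasDerivAt_of_ofReal ((hv.d₃ x t hx).congr_of_eventuallyEq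
      ((hxo x hx).mono fun z hz => (h2 z hz).symm))
  have h4 : vt x t = ((deriv (fun s => r x s) t : ℝ) : ℂ) :=
    hasDerivAt_of_ofReal ((hv.dt x t hx).congr_of_eventuallyEq
      (hto.mono fun s hs => (hr x s hs).symm))
  have h5 := hv.eqn x t hx
  rw [h1 x hx, h3, h4, hr x t hx] at h5
  rw [iteratedDeriv_succ, iteratedDeriv_succ, iteratedDeriv_one]
  exact_mod_cast h5

lemma isSolOn_uCn (hk0 : 0 < k) (hk1 : k < 1) (Ω : Set (ℝ × ℝ)) :
    IsSolOn Ω (fun x t => (uCn k x t : ℂ)) (fun x t => (uCnX k x t : ℂ))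
      (fun x t => (cnSpeed k : ℂ) * uCn k x t - 2 * (uCn k x t : ℂ) ^ 3)
      (fun x t => (cnSpeed k : ℂ) * uCnX k x t - 6 * (uCn k x t : ℂ) ^ 2 * uCnX k x t)
      (fun x t => -(cnSpeed k : ℂ) * uCnX k x t) where
  d₁ x t _ := (hasDerivAt_uCn_x hk0.le hk1 x t).ofReal_comp
  d₂ x t _ := by
    refine (hasDerivAt_uCnX_x hk0.le hk1 x t).ofReal_comp.congr_deriv ?_
    push_cast; ring
  d₃ x t _ := by
    have h := (hasDerivAt_uCnXX_x hk0.le hk1 x t).ofReal_comp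
    push_cast at h
    exact h
  dt x t _ := by
    refine (hasDerivAt_uCn_t hk0.le hk1 x t).ofReal_comp.congr_deriv ?_
    push_cast; ring
  eqn x t _ := by ring

lemma IsLaxOn.mono {Ω Ω' : Set (ℝ × ℝ)} {lam : ℂ} {u u₁ u₂ p q : ℝ → ℝ → ℂ}
    (h : IsLaxOn Ω lam u u₁ u₂ p q) (hs : Ω' ⊆ Ω) : IsLaxOn Ω' lam u u₁ u₂ p q :=
  ⟨fun x t hx => h.px x t (hs hx), fun x t hx => h.qx x t (hs hx),
    fun x t hx => h.pt x t (hs hx), fun x t hx => h.qt x t (hs hx)⟩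

/-- The left-hand side of the mKdV equation is continuous in `x` for smooth `u`. -/
lemma continuous_residual {r : ℝ → ℝ → ℝ} (hr : ContDiff ℝ ∞ (fun p : ℝ × ℝ => r p.1 p.2))
    (t : ℝ) : Continuous (fun x => deriv (fun s => r x s) t +
      6 * r x t ^ 2 * deriv (fun y => r y t) x + iteratedDeriv 3 (fun y => r y t) x) := by
  have hslice : ContDiff ℝ ∞ (fun y => r y t) := hr.comp (contDiff_id.prodMk contDiff_const)
  have h1 : ∀ y, deriv (fun s => r y s) t =
      fderiv ℝ (fun p : ℝ × ℝ => r p.1 p.2) (y, t) (0, 1) := fun y => by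
    have h2 : HasDerivAt (fun s : ℝ => ((y, s) : ℝ × ℝ)) (0, 1) t :=
      (hasDerivAt_const t y).prodMk (hasDerivAt_id t)
    exact ((hr.differentiable (by simp) (y, t)).hasFDerivAt.comp_hasDerivAt t h2).deriv
  have htime : Continuous (fun y => deriv (fun s => r y s) t) := by
    simp only [h1]
    exact ((hr.continuous_fderiv (by simp)).comp (Continuous.prodMk_left t)).clm_apply
      continuous_const
  exact (htime.add ((continuous_const.mul (hslice.continuous.pow 2)).mul
    (hslice.continuous_deriv (by simp)))).add
    ((contDiff_infty.mp hslice 3).continuous_iteratedDeriv 3 le_rfl)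

/-- The zeros of `psiSum` are isolated in `x`. -/
lemma eventually_psiSum_ne_zero (hk0 : 0 < k) (hk1 : k < 1) (x t : ℝ) :
    ∀ᶠ y in nhdsWithin x {x}ᶜ, psiSum k y t ≠ 0 := by
  obtain ⟨φ₁, φ₂, hφ⟩ := exists_isCnEigenfunction hk0 hk1
  obtain ⟨hlax, hv⟩ := (isCnEigenfunction_iff hk0 hk1).mp hφ
  have hpsi := isCnLaxOn_psi hk0 hk1 hlax hv
  by_cases hx : psiSum k x t = 0
  · have ha : psi₁ k φ₂ x t ^ 2 + psi₂ k φ₁ x t ^ 2 = 0 := by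
      rw [psi_sq_add_sq (hv x t) hk0, hx, zero_div]
    have hd : HasDerivAt (fun y => psi₁ k φ₂ y t ^ 2 + psi₂ k φ₁ y t ^ 2)
        (2 * lamI k * (psi₁ k φ₂ x t ^ 2 - psi₂ k φ₁ x t ^ 2)) x := by
      refine (((hpsi.px x t trivial).pow 2).add ((hpsi.qx x t trivial).pow 2)).congr_deriv ?_
      push_cast
      ring
    -- The zero is simple: otherwise `ψ₁ = ψ₂ = 0`, contradicting Wronskian 2.
    have hne : 2 * lamI k * (psi₁ k φ₂ x t ^ 2 - psi₂ k φ₁ x t ^ 2) ≠ 0 := by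
      refine mul_ne_zero (mul_ne_zero two_ne_zero (lamI_ne_zero hk0)) fun hb => ?_
      have h1 : psi₁ k φ₂ x t ^ 2 = 0 := by linear_combination (ha + hb) / 2
      have h2 : psi₂ k φ₁ x t ^ 2 = 0 := by linear_combination (ha - hb) / 2
      have h3 := wronskian_psi hv x t
      rw [pow_eq_zero_iff two_ne_zero] at h1 h2
      rw [h1, h2] at h3
      norm_num at h3
    filter_upwards [hd.eventually_ne hne (c := 0)] with y hy
    rw [psi_sq_add_sq (hv y t) hk0] at hy
    exact fun h => hy (by rw [h, zero_div])
  · have hc : Continuous fun y => psiSum k y t := by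
      have h := (contDiff_psiSum hk0 hk1).continuous.comp
        (continuous_id.prodMk (continuous_const (y := t)))
      simp only [Function.comp_def] at h
      exact h
    exact (hc.continuousAt.eventually_ne hx).filter_mono nhdsWithin_le_nhds

/-- The hypothesis marks the points where the intermediate one-fold potential exists; that potential
is complex, and only the final one is real. -/
lemma uCnRogue_eqn_of_psiSum_ne_zero (hk0 : 0 < k) (hk1 : k < 1) {x t : ℝ}
    (hx : psiSum k x t ≠ 0) :
    deriv (fun s => uCnRogue k x s) t +
      6 * uCnRogue k x t ^ 2 * deriv (fun y => uCnRogue k y t) x +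
      iteratedDeriv 3 (fun y => uCnRogue k y t) x = 0 := by
  obtain ⟨φ₁, φ₂, hφ⟩ := exists_isCnEigenfunction hk0 hk1
  obtain ⟨hlax, hv⟩ := (isCnEigenfunction_iff hk0 hk1).mp hφ
  have hpsi := isCnLaxOn_psi hk0 hk1 hlax hv
  set Ω : Set (ℝ × ℝ) := {p | psiSum k p.1 p.2 ≠ 0} with hΩ
  have hopen : IsOpen Ω := isOpen_ne_fun (contDiff_psiSum hk0 hk1).continuous continuous_const
  obtain ⟨v, v₁, v₂, v₃, vt, hsol, hveq⟩ := exists_isSolOn_twoFoldDarboux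
    (isSolOn_uCn hk0 hk1 Ω) (hpsi.mono (Set.subset_univ Ω)) (hpsi.conj.mono (Set.subset_univ Ω))
    (fun x t hx => by
      rw [psi_sq_add_sq (hv x t) hk0]
      exact div_ne_zero hx (pow_ne_zero 2 (mul_ne_zero (hv x t).P_ne (hv x t).Q_ne)))
    (fun x t _ => twoFoldDenom_psi_ne_zero hk0 hk1 (hv x t))
  exact hsol.real_eqn hopen
    (fun x t hx => (hveq x t hx).trans (twoFoldDarboux_psi hk0 hk1 (hv x t))) hx

/-- At fixed `t` the mKdV residual is continuous in `x` and vanishes on a punctured neighbourhood of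
each point, hence at the point. -/
theorem isSolution_uCnRogue (hk0 : 0 < k) (hk1 : k < 1) : IsSolution (uCnRogue k) := by
  have hsmooth := contDiff_uCnRogue hk0 hk1
  refine ⟨hsmooth, fun x t => ?_⟩
  have hres := continuous_residual hsmooth t
  have hlim := (hres.tendsto x).mono_left (nhdsWithin_le_nhds (s := {x}ᶜ))
  have heq : (fun x => deriv (fun s => uCnRogue k x s) t +
      6 * uCnRogue k x t ^ 2 * deriv (fun y => uCnRogue k y t) x +
      iteratedDeriv 3 (fun y => uCnRogue k y t) x) =ᶠ[nhdsWithin x {x}ᶜ] fun _ => 0 :=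
    (eventually_psiSum_ne_zero hk0 hk1 x t).mono fun y hy =>
      uCnRogue_eqn_of_psiSum_ne_zero hk0 hk1 hy
  exact tendsto_nhds_unique (hlim.congr' heq) tendsto_const_nhds

end Solution

/-! ### The limit at infinity -/

section Limit

variable {k : ℝ}

/-- `|θ|⁻⁴ G₁` as a function of `u`, `u_x` and `θ⁻¹`. -/
def scaledG₁ (k : ℝ) (r : (ℝ × ℝ) × ℂ) : ℝ :=
  4 * kap k * (((r.1.1 : ℂ) ^ 2 + Complex.I * (kap k : ℂ)) * (r.2 ^ 2 - 1) *
    starRingEnd ℂ ((r.2 ^ 2 + 1) * r.1.1 - (lamI k)⁻¹ * r.2 * r.1.2)).im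

/-- `|θ|⁻⁴ G₂` as a function of `u`, `u_x` and `θ⁻¹`. -/
def scaledG₂ (k : ℝ) (r : (ℝ × ℝ) × ℂ) : ℝ :=
  (1 - 2 * k ^ 2) * ‖(r.2 ^ 2 + 1) * r.1.1 - (lamI k)⁻¹ * r.2 * r.1.2‖ ^ 2
    + ‖r.2 ^ 2 - 1‖ ^ 2 * (r.1.1 ^ 4 + k ^ 2 * (1 - k ^ 2))
    + ‖(r.2 ^ 2 + 1) * (2 * lamI k)⁻¹ * r.1.2 - 2 * r.2 * r.1.1‖ ^ 2

lemma continuous_scaledG₁ (k : ℝ) : Continuous (scaledG₁ k) := by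
  unfold scaledG₁
  refine continuous_const.mul (Complex.continuous_im.comp (Continuous.mul ?_
    (Complex.continuous_conj.comp ?_))) <;> fun_prop

lemma continuous_scaledG₂ (k : ℝ) : Continuous (scaledG₂ k) := by
  unfold scaledG₂
  fun_prop

lemma G₁_eq_scaled {x t : ℝ} (h : thetaCn k x t ≠ 0) :
    G₁ k x t = ‖thetaCn k x t‖ ^ 4 *
      scaledG₁ k ((uCn k x t, uCnX k x t), (thetaCn k x t)⁻¹) := by
  have hs : psiSum k x t = thetaCn k x t ^ 2 * (((thetaCn k x t)⁻¹ ^ 2 + 1) * uCn k x t -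
      (lamI k)⁻¹ * (thetaCn k x t)⁻¹ * uCnX k x t) := by
    rw [psiSum]; field_simp
  have ht : 1 - thetaCn k x t ^ 2 = thetaCn k x t ^ 2 * ((thetaCn k x t)⁻¹ ^ 2 - 1) := by
    field_simp
  rw [G₁_eq, hs, ht, scaledG₁]
  set θ := thetaCn k x t
  set a := ((θ)⁻¹ ^ 2 + 1) * (uCn k x t : ℂ) - (lamI k)⁻¹ * (θ)⁻¹ * uCnX k x t
  have hn : ((‖θ‖ ^ 4 : ℝ) : ℂ) = θ ^ 2 * starRingEnd ℂ (θ ^ 2) := by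
    rw [Complex.mul_conj', norm_pow]
    push_cast
    ring
  have h1 : ((uCn k x t : ℂ) ^ 2 + Complex.I * kap k) * (θ ^ 2 * ((θ)⁻¹ ^ 2 - 1)) *
      starRingEnd ℂ (θ ^ 2 * a) = ((‖θ‖ ^ 4 : ℝ) : ℂ) *
        (((uCn k x t : ℂ) ^ 2 + Complex.I * kap k) * ((θ)⁻¹ ^ 2 - 1) * starRingEnd ℂ a) := by
    rw [hn, map_mul]; ring
  rw [h1, Complex.im_ofReal_mul]
  ring

lemma G₂_eq_scaled {x t : ℝ} (h : thetaCn k x t ≠ 0) :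
    G₂ k x t = ‖thetaCn k x t‖ ^ 4 *
      scaledG₂ k ((uCn k x t, uCnX k x t), (thetaCn k x t)⁻¹) := by
  have hs : psiSum k x t = thetaCn k x t ^ 2 * (((thetaCn k x t)⁻¹ ^ 2 + 1) * uCn k x t -
      (lamI k)⁻¹ * (thetaCn k x t)⁻¹ * uCnX k x t) := by
    rw [psiSum]; field_simp
  have hd : psiDiff k x t = thetaCn k x t ^ 2 * (((thetaCn k x t)⁻¹ ^ 2 + 1) *
      (2 * lamI k)⁻¹ * uCnX k x t - 2 * (thetaCn k x t)⁻¹ * uCn k x t) := by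
    rw [psiDiff]; field_simp
  have ht : 1 - thetaCn k x t ^ 2 = thetaCn k x t ^ 2 * ((thetaCn k x t)⁻¹ ^ 2 - 1) := by
    field_simp
  rw [G₂_eq, hs, hd, ht, scaledG₂]
  simp only [norm_mul (thetaCn k x t ^ 2), norm_pow]
  ring

lemma scaledG₁_zero (hk0 : 0 < k) (hk1 : k < 1) (a b : ℝ) :
    scaledG₁ k ((a, b), 0) = -(4 * (k ^ 2 * (1 - k ^ 2)) * a) := by
  rw [← kap_sq hk0 hk1]
  have h : ((a : ℂ) ^ 2 + Complex.I * kap k) * ((0 : ℂ) ^ 2 - 1) *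
      starRingEnd ℂ (((0 : ℂ) ^ 2 + 1) * a - (lamI k)⁻¹ * 0 * b) =
      ((-a ^ 3 : ℝ) : ℂ) + ((-kap k * a : ℝ) : ℂ) * Complex.I := by
    simp only [map_sub, map_mul, map_add, map_pow, map_zero, map_one, Complex.conj_ofReal]
    push_cast
    ring
  simp only [scaledG₁]
  rw [h, Complex.add_im, Complex.ofReal_im, Complex.mul_I_im, Complex.ofReal_re]
  ring

lemma scaledG₂_zero (hk0 : 0 < k) (hk1 : k < 1) {a b : ℝ}
    (h : b ^ 2 = (k ^ 2 - a ^ 2) * (1 - k ^ 2 + a ^ 2)) :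
    scaledG₂ k ((a, b), 0) = 2 * (k ^ 2 * (1 - k ^ 2)) := by
  simp only [scaledG₂, ne_eq, OfNat.ofNat_ne_zero, not_false_eq_true, zero_pow, zero_add, one_mul,
    mul_zero, zero_mul, sub_zero, zero_sub, norm_neg, norm_one, norm_mul, norm_inv,
    norm_lamI hk0 hk1, Complex.norm_real, Real.norm_eq_abs, sq_abs, mul_pow, RCLike.norm_ofNat]
  rw [h]
  ring

/-- `(u, u_x)` need not converge, so `1/θ → 0` is combined with compactness: `((u, u_x), 1/θ)` tends
to the neighbourhood filter of `K × {0}`, and on that set the continuous scaled quotient equals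
`-2u`. -/
theorem tendsto_uCnRogue_add_uCn (hk0 : 0 < k) (hk1 : k < 1) :
    Filter.Tendsto (fun p : ℝ × ℝ => uCnRogue k p.1 p.2 - (-uCn k p.1 p.2))
      (Filter.comap (fun p : ℝ × ℝ => |p.1| + |p.2|) Filter.atTop) (nhds 0) := by
  set l := Filter.comap (fun p : ℝ × ℝ => |p.1| + |p.2|) Filter.atTop with hl
  have hκ : 0 < k ^ 2 * (1 - k ^ 2) := mul_pos (by positivity) (by nlinarith)
  set K : Set (ℝ × ℝ) := (Set.Icc (-k) k ×ˢ Set.Icc (-1) 1) ∩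
    {p | p.2 ^ 2 = (k ^ 2 - p.1 ^ 2) * (1 - k ^ 2 + p.1 ^ 2)} with hK
  have hKc : IsCompact K := (isCompact_Icc.prod isCompact_Icc).inter_right
    (isClosed_eq (by fun_prop) (by fun_prop))
  have hmem : ∀ p : ℝ × ℝ, (uCn k p.1 p.2, uCnX k p.1 p.2) ∈ K := fun p => by
    have h1 := abs_le.mp (abs_uCn_le hk0.le p.1 p.2)
    have h2 := uCnX_sq hk0.le hk1 p.1 p.2
    have h3 : uCn k p.1 p.2 ^ 2 ≤ k ^ 2 := sq_le_sq' h1.1 h1.2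
    refine ⟨⟨h1, ?_⟩, h2⟩
    rw [Set.mem_Icc, ← abs_le]
    refine abs_le_one_iff_mul_self_le_one.mpr ?_
    nlinarith [sq_nonneg (uCn k p.1 p.2)]
  have hθ : Filter.Tendsto (fun p : ℝ × ℝ => (thetaCn k p.1 p.2)⁻¹) l (nhds 0) :=
    tendsto_zero_iff_norm_tendsto_zero.mpr (by
      simp only [norm_inv]
      exact (tendsto_norm_thetaCn hk0 hk1).inv_tendsto_atTop)
  have hprod : Filter.Tendsto (fun p : ℝ × ℝ =>
      ((uCn k p.1 p.2, uCnX k p.1 p.2), (thetaCn k p.1 p.2)⁻¹)) l (nhdsSet (K ×ˢ {0})) := by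
    rw [hKc.nhdsSet_prod_eq isCompact_singleton, nhdsSet_singleton]
    exact ((Filter.tendsto_principal.mpr (Filter.Eventually.of_forall hmem)).mono_right
      principal_le_nhdsSet).prodMk hθ
  have hΦ : Filter.Tendsto (fun r => scaledG₁ k r / scaledG₂ k r + 2 * r.1.1)
      (nhdsSet (K ×ˢ {0})) (nhds 0) := by
    intro s hs
    rw [Filter.mem_map, mem_nhdsSet_iff_forall]
    rintro ⟨⟨a, b⟩, z⟩ ⟨hab, hz⟩
    obtain rfl : z = 0 := hz
    have h2 := scaledG₂_zero hk0 hk1 hab.2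
    have hne : scaledG₂ k ((a, b), 0) ≠ 0 := by rw [h2]; positivity
    have hc : ContinuousAt (fun r => scaledG₁ k r / scaledG₂ k r + 2 * r.1.1)
        ((a, b), (0 : ℂ)) :=
      ((continuous_scaledG₁ k).continuousAt.div (continuous_scaledG₂ k).continuousAt hne).add
        (by fun_prop)
    have h0 : scaledG₁ k ((a, b), 0) / scaledG₂ k ((a, b), 0) + 2 * a = 0 := by
      have h3 : 1 - k ^ 2 ≠ 0 := right_ne_zero_of_mul hκ.ne'
      rw [h2, scaledG₁_zero hk0 hk1]
      field_simp
      ring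
    refine hc ?_
    change s ∈ nhds (scaledG₁ k ((a, b), 0) / scaledG₂ k ((a, b), 0) + 2 * a)
    rwa [h0]
  refine (hΦ.comp hprod).congr' ?_
  filter_upwards [(tendsto_norm_thetaCn hk0 hk1).eventually (Filter.eventually_gt_atTop 0)]
    with p hp
  have hne : thetaCn k p.1 p.2 ≠ 0 := norm_pos_iff.mp hp
  simp only [Function.comp_apply, uCnRogue]
  rw [G₁_eq_scaled hne, G₂_eq_scaled hne, mul_div_mul_left _ _ (by positivity)]
  ring

end Limit

/-! ### The local maximum at the origin -/

section LocalMax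

variable {k : ℝ}

lemma lamI_inv (hk0 : 0 < k) (hk1 : k < 1) :
    (lamI k)⁻¹ = 2 * ((k : ℂ) - Complex.I * (Real.sqrt (1 - k ^ 2) : ℂ)) := by
  have h := four_mul_lamI_mul_conj hk0 hk1
  have hl := lamI_ne_zero hk0
  have h2 : starRingEnd ℂ (lamI k) = ((k : ℂ) - Complex.I * (Real.sqrt (1 - k ^ 2) : ℂ)) / 2 := by
    simp only [lamI, map_div₀, map_add, map_mul, Complex.conj_ofReal, Complex.conj_I, map_ofNat]
    ring
  rw [h2] at h
  field_simp
  linear_combination -h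

/-- Real coordinates `u, w = u_x, θ = α + iβ` turn the local maximum into a polynomial inequality
near `(k, 0, 0, 0)`. -/
lemma G₂_real (hk0 : 0 < k) (hk1 : k < 1) (x t : ℝ) :
    let s := Real.sqrt (1 - k ^ 2)
    let u := uCn k x t
    let w := uCnX k x t
    let α := (thetaCn k x t).re
    let β := (thetaCn k x t).im
    let n := α ^ 2 + β ^ 2
    G₂ k x t = 2 * k ^ 2 * s ^ 2 * (1 + n ^ 2) - 4 * (α ^ 2 - β ^ 2) * u ^ 4
      + 4 * n * (u ^ 2 + (1 - 2 * k ^ 2) * w ^ 2)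
      - 8 * k * s * u * w * ((s * α - k * β) + n * (s * α + k * β)) := by
  intro s u w α β n
  have hs : s ^ 2 = 1 - k ^ 2 := sq_sqrt_one_sub_sq hk0 hk1
  have hw : w ^ 2 = (k ^ 2 - u ^ 2) * (1 - k ^ 2 + u ^ 2) := uCnX_sq hk0.le hk1 x t
  rw [G₂_eq]
  have hθ : thetaCn k x t = (α : ℂ) + (β : ℂ) * Complex.I := (Complex.re_add_im _).symm
  have hA : psiSum k x t = (((1 + α ^ 2 - β ^ 2) * u - 2 * (k * α + s * β) * w : ℝ) : ℂ) +
      ((2 * α * β * u - 2 * (k * β - s * α) * w : ℝ) : ℂ) * Complex.I := by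
    rw [psiSum, lamI_inv hk0 hk1, hθ]
    push_cast
    change (1 + _) * (u : ℂ) - _ * _ * (w : ℂ) = _
    linear_combination ((β : ℂ) ^ 2 * u + 2 * s * β * w) * Complex.I_sq
  have hB : psiDiff k x t = ((((1 + α ^ 2 - β ^ 2) * k + 2 * α * β * s) * w - 2 * α * u : ℝ) : ℂ) +
      (((2 * α * β * k - s * (1 + α ^ 2 - β ^ 2)) * w - 2 * β * u : ℝ) : ℂ) * Complex.I := by
    rw [psiDiff, mul_inv, lamI_inv hk0 hk1, hθ]
    push_cast
    change (1 + _) * _ * (w : ℂ) - _ * (u : ℂ) = _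
    linear_combination ((β : ℂ) ^ 2 * k * w - 2 * α * β * s * w -
      (β : ℂ) ^ 2 * s * w * Complex.I) * Complex.I_sq
  have hT : 1 - thetaCn k x t ^ 2 = ((1 - α ^ 2 + β ^ 2 : ℝ) : ℂ) +
      ((-2 * α * β : ℝ) : ℂ) * Complex.I := by
    rw [hθ]
    push_cast
    linear_combination -(β : ℂ) ^ 2 * Complex.I_sq
  rw [hA, hB, hT]
  simp only [← Complex.normSq_eq_norm_sq, Complex.normSq_add_mul_I]
  change (1 - 2 * k ^ 2) * _ + _ * (u ^ 4 + _) + _ = _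
  simp only [n]
  generalize u = u at *
  generalize w = w at *
  generalize α = α at *
  generalize β = β at *
  generalize s = s at *
  grind

lemma G₁_real (hk0 : 0 < k) (hk1 : k < 1) (x t : ℝ) :
    let s := Real.sqrt (1 - k ^ 2)
    let u := uCn k x t
    let w := uCnX k x t
    let α := (thetaCn k x t).re
    let β := (thetaCn k x t).im
    let n := α ^ 2 + β ^ 2
    G₁ k x t = 4 * k * s * (k * s * (1 - n ^ 2) * u - 4 * α * β * u ^ 3
      - 2 * w * (u ^ 2 * (s * α * (1 - n) - k * β * (1 + n))
        + k * s * (k * α * (1 - n) + s * β * (1 + n)))) := by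
  intro s u w α β n
  have hs : s ^ 2 = 1 - k ^ 2 := sq_sqrt_one_sub_sq hk0 hk1
  have hθ : thetaCn k x t = (α : ℂ) + (β : ℂ) * Complex.I := (Complex.re_add_im _).symm
  have hA : psiSum k x t = (((1 + α ^ 2 - β ^ 2) * u - 2 * (k * α + s * β) * w : ℝ) : ℂ) +
      ((2 * α * β * u - 2 * (k * β - s * α) * w : ℝ) : ℂ) * Complex.I := by
    rw [psiSum, lamI_inv hk0 hk1, hθ]
    push_cast
    change (1 + _) * (u : ℂ) - _ * _ * (w : ℂ) = _
    linear_combination ((β : ℂ) ^ 2 * u + 2 * s * β * w) * Complex.I_sq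
  have hT : 1 - thetaCn k x t ^ 2 = ((1 - α ^ 2 + β ^ 2 : ℝ) : ℂ) +
      ((-2 * α * β : ℝ) : ℂ) * Complex.I := by
    rw [hθ]
    push_cast
    linear_combination -(β : ℂ) ^ 2 * Complex.I_sq
  have hW : (uCn k x t : ℂ) ^ 2 + Complex.I * (kap k : ℂ) =
      ((u ^ 2 : ℝ) : ℂ) + ((k * s : ℝ) : ℂ) * Complex.I := by
    rw [kap]
    push_cast
    ring
  rw [G₁_eq, hA, hT, hW, kap]
  simp only [Complex.mul_im, Complex.mul_re, Complex.add_im, Complex.add_re, Complex.conj_re,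
    Complex.conj_im, Complex.ofReal_re, Complex.ofReal_im, Complex.I_re, Complex.I_im]
  change 4 * (k * s) * _ = _
  simp only [n]
  ring

end LocalMax

/-! ### Quantitative upper bound near the origin, and its consequences. -/

section Maximum

variable {k : ℝ}

/-- This form is the quadratic part of the gap `(3k - u)G₂ - G₁` that remains in reserve in
`gap_le`; coercivity lets it absorb the error terms there. -/
lemma quadratic_form_coercive {k s : ℝ} (hk0 : 0 < k) (hk1 : k < 1) (hs0 : 0 < s) (w α β : ℝ) :
    α ^ 2 + β ^ 2 + w ^ 2 ≤ (9 / (4 * k ^ 3 * s ^ 2) + 1 / k ^ 3 + 2 / (k * s ^ 2)) *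
      (k * s ^ 2 / 2 * w ^ 2 + 8 * k ^ 3 * (s * α + k * β) ^ 2
        + 2 * k * (2 * k * β + s * w) ^ 2) := by
  set q := k * s ^ 2 / 2 * w ^ 2 + 8 * k ^ 3 * (s * α + k * β) ^ 2
    + 2 * k * (2 * k * β + s * w) ^ 2 with hq
  have h1 : 0 ≤ k * s ^ 2 / 2 * w ^ 2 := by positivity
  have h2 : 0 ≤ 8 * k ^ 3 * (s * α + k * β) ^ 2 := by positivity
  have h3 : 0 ≤ 2 * k * (2 * k * β + s * w) ^ 2 := by positivity
  have hw : w ^ 2 ≤ 2 / (k * s ^ 2) * q := by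
    rw [div_mul_eq_mul_div, le_div_iff₀ (by positivity)]
    linarith
  have hβ' : k ^ 3 * β ^ 2 ≤ q := by
    have := mul_nonneg hk0.le (sq_nonneg (2 * k * β + 2 * s * w))
    nlinarith
  have hβ : β ^ 2 ≤ 1 / k ^ 3 * q := by
    rw [div_mul_eq_mul_div, le_div_iff₀ (by positivity)]
    linarith
  have hα : α ^ 2 ≤ 9 / (4 * k ^ 3 * s ^ 2) * q := by
    rw [div_mul_eq_mul_div, le_div_iff₀ (by positivity)]
    -- Four times this square is `4k³s²α² ≤ 8k³(sα + kβ)² + 8k⁵β²`, and the right side is at most `q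
    -- + 8q`; hence the constant 9.
    have h4 := mul_nonneg (pow_pos hk0 3).le (sq_nonneg (s * α + 2 * k * β))
    have h5 : 8 * k ^ 2 * (k ^ 3 * β ^ 2) ≤ 8 * q := by
      have : k ^ 2 ≤ 1 := by nlinarith
      have h6 : 0 ≤ k ^ 3 * β ^ 2 := by positivity
      nlinarith
    linarith
  linarith

lemma abs_mul_le_sq_add_sq (y z : ℝ) : |y * z| ≤ y ^ 2 + z ^ 2 := by
  rw [abs_le]
  constructor <;> nlinarith [sq_nonneg (y + z), sq_nonneg (y - z)]

lemma sq_le_of_curve {k u w : ℝ} (hu : |u| ≤ k)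
    (hw : w ^ 2 = (k ^ 2 - u ^ 2) * (1 - k ^ 2 + u ^ 2)) : w ^ 2 ≤ 2 * k * (k - u) := by
  obtain ⟨hu1, hu2⟩ := abs_le.mp hu
  have h6 : u ^ 2 ≤ k ^ 2 := sq_le_sq' hu1 hu2
  have h8 : (k ^ 2 - u ^ 2) * (1 - k ^ 2 + u ^ 2) ≤ k ^ 2 - u ^ 2 :=
    mul_le_of_le_one_right (by linarith) (by linarith)
  nlinarith [sq_nonneg (k - u)]

/-- A lower bound for `(3k - u) G₂ - G₁` in terms of `u`, `u_x` and `θ = α + iβ`, provided that the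
coefficients of the error terms are small. -/
lemma gap_le {k s u w α β n ε eh en eg ea eb : ℝ} (hk0 : 0 < k) (hs0 : 0 < s)
    (hs : s ^ 2 = 1 - k ^ 2) (hn : n = α ^ 2 + β ^ 2) (hu : |u| ≤ k)
    (hw : w ^ 2 = (k ^ 2 - u ^ 2) * (1 - k ^ 2 + u ^ 2)) (hε0 : 0 < ε)
    (hε : 5 * ε * (n + w ^ 2) ≤ k * s ^ 2 / 2 * w ^ 2 + 8 * k ^ 3 * (s * α + k * β) ^ 2
      + 2 * k * (2 * k * β + s * w) ^ 2)
    (heh : eh = -4 * ((3 * k - u) * u ^ 4 - 2 * k ^ 5))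
    (hen : en = 4 * ((3 * k - u) * (u ^ 2 + (1 - 2 * k ^ 2) * w ^ 2) - 2 * k ^ 3))
    (heg : eg = 16 * k * s * (u ^ 3 - k ^ 3))
    (hea : ea = -8 * k * s ^ 2 * u * (3 * k - u) * (1 + n)
      + 8 * k * s ^ 2 * (u ^ 2 + k ^ 2) * (1 - n))
    (heb : eb = -8 * k ^ 2 * s * u * (3 * k - u) * (n - 1)
      + 8 * k ^ 2 * s * (s ^ 2 - u ^ 2) * (1 + n) - 8 * k ^ 2 * s)
    (h1 : |eh| < ε) (h2 : |en| < ε) (h3 : |eg| < ε) (h4 : |ea| < ε) (h5 : |eb| < ε) :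
    k ^ 2 * s ^ 2 * (k - u) ≤ (3 * k - u) *
        (2 * k ^ 2 * s ^ 2 * (1 + n ^ 2) - 4 * (α ^ 2 - β ^ 2) * u ^ 4
          + 4 * n * (u ^ 2 + (1 - 2 * k ^ 2) * w ^ 2)
          - 8 * k * s * u * w * ((s * α - k * β) + n * (s * α + k * β))) -
        4 * k * s * (k * s * (1 - n ^ 2) * u - 4 * α * β * u ^ 3
          - 2 * w * (u ^ 2 * (s * α * (1 - n) - k * β * (1 + n))
            + k * s * (k * α * (1 - n) + s * β * (1 + n)))) := by
  obtain ⟨hu1, hu2⟩ := abs_le.mp hu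
  have hw2 := sq_le_of_curve hu hw
  have hn0 : 0 ≤ n := by rw [hn]; positivity
  have hbound : ∀ e y m : ℝ, |e| < ε → |y| ≤ m → -(ε * m) ≤ e * y := by
    intro e y m he hy
    have h6 : |e * y| ≤ ε * m := by
      rw [abs_mul]
      exact mul_le_mul he.le hy (abs_nonneg _) hε0.le
    exact (abs_le.mp h6).1
  have hα2 := sq_nonneg α
  have hβ2 := sq_nonneg β
  have hw0 := sq_nonneg w
  have b1 := hbound eh (α ^ 2 - β ^ 2) (n + w ^ 2) h1
    (by rw [abs_le]; constructor <;> linarith only [hn, hα2, hβ2, hw0])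
  have b2 := hbound en n (n + w ^ 2) h2 (by rw [abs_of_nonneg hn0]; linarith only [hw0])
  have b3 := hbound eg (α * β) (n + w ^ 2) h3 ((abs_mul_le_sq_add_sq α β).trans (by linarith only [hn, hα2, hβ2, hw0]))
  have b4 := hbound ea (w * α) (n + w ^ 2) h4 ((abs_mul_le_sq_add_sq w α).trans (by linarith only [hn, hα2, hβ2, hw0]))
  have b5 := hbound eb (w * β) (n + w ^ 2) h5 ((abs_mul_le_sq_add_sq w β).trans (by linarith only [hn, hα2, hβ2, hw0]))
  have hn2 : 0 ≤ 2 * k ^ 2 * s ^ 2 * n ^ 2 * (3 * k + u) :=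
    mul_nonneg (by positivity) (by linarith)
  have hδ : k * s ^ 2 * w ^ 2 ≤ k * s ^ 2 * (2 * k * (k - u)) :=
    mul_le_mul_of_nonneg_left hw2 (by positivity)
  -- Exact expansion; the coefficients `eh`, `en`, `eg`, `ea`, `eb` vanish at the origin. By `w² ≤
  -- 2k(k - u)` the negative `w²` term costs at most five of the six multiples of `k²s²(k - u)`,
  -- leaving one. The reserved form covers the five errors, each at most `ε(n + w²)`.
  have key : (3 * k - u) *
        (2 * k ^ 2 * s ^ 2 * (1 + n ^ 2) - 4 * (α ^ 2 - β ^ 2) * u ^ 4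
          + 4 * n * (u ^ 2 + (1 - 2 * k ^ 2) * w ^ 2)
          - 8 * k * s * u * w * ((s * α - k * β) + n * (s * α + k * β))) -
        4 * k * s * (k * s * (1 - n ^ 2) * u - 4 * α * β * u ^ 3
          - 2 * w * (u ^ 2 * (s * α * (1 - n) - k * β * (1 + n))
            + k * s * (k * α * (1 - n) + s * β * (1 + n)))) =
      6 * k ^ 2 * s ^ 2 * (k - u) + 2 * k ^ 2 * s ^ 2 * n ^ 2 * (3 * k + u)
        - 5 / 2 * (k * s ^ 2 * w ^ 2) + (k * s ^ 2 / 2 * w ^ 2 + 8 * k ^ 3 * (s * α + k * β) ^ 2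
      + 2 * k * (2 * k * β + s * w) ^ 2)
        + eh * (α ^ 2 - β ^ 2) + en * n + eg * (α * β) + ea * (w * α) + eb * (w * β) := by
    rw [heh, hen, heg, hea, heb]
    linear_combination -8 * k ^ 3 * α ^ 2 * hs + 8 * k ^ 3 * hn
  rw [key]
  linarith only [b1, b2, b3, b4, b5, hn2, hδ, hε]

/-- The lower bound for `(3k - u) G₂ - G₁` near the origin, in terms of `u`, `u_x` and `θ`. -/
lemma eventually_gap {s : ℝ} (hk0 : 0 < k) (hk1 : k < 1) (hs0 : 0 < s) (hs : s ^ 2 = 1 - k ^ 2) :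
    ∀ᶠ r : (ℝ × ℝ) × (ℝ × ℝ) in nhds ((k, 0), (0, 0)), ∀ u w α β n : ℝ,
      r = ((u, w), (α, β)) → n = α ^ 2 + β ^ 2 → |u| ≤ k →
      w ^ 2 = (k ^ 2 - u ^ 2) * (1 - k ^ 2 + u ^ 2) →
      k ^ 2 * s ^ 2 * (k - u) ≤ (3 * k - u) *
        (2 * k ^ 2 * s ^ 2 * (1 + n ^ 2) - 4 * (α ^ 2 - β ^ 2) * u ^ 4
          + 4 * n * (u ^ 2 + (1 - 2 * k ^ 2) * w ^ 2)
          - 8 * k * s * u * w * ((s * α - k * β) + n * (s * α + k * β))) -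
        4 * k * s * (k * s * (1 - n ^ 2) * u - 4 * α * β * u ^ 3
          - 2 * w * (u ^ 2 * (s * α * (1 - n) - k * β * (1 + n))
            + k * s * (k * α * (1 - n) + s * β * (1 + n)))) := by
  set M := 9 / (4 * k ^ 3 * s ^ 2) + 1 / k ^ 3 + 2 / (k * s ^ 2) with hM
  have hM0 : 0 < M := by positivity
  -- One fifth of the coercivity constant `1/M` for each of the five error terms.
  have hε0 : 0 < 1 / (5 * M) := by positivity
  have hsmall : ∀ f : (ℝ × ℝ) × (ℝ × ℝ) → ℝ, Continuous f → f ((k, 0), (0, 0)) = 0 →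
      ∀ᶠ r in nhds ((k, 0), (0, 0)), |f r| < 1 / (5 * M) := by
    intro f hf h0
    have h1 : Continuous fun r => |f r| := hf.abs
    exact h1.continuousAt.eventually_lt_const (by simpa only [h0, abs_zero] using hε0)
  have e1 := hsmall (fun r => -4 * ((3 * k - r.1.1) * r.1.1 ^ 4 - 2 * k ^ 5)) (by fun_prop)
    (by ring)
  have e2 := hsmall (fun r => 4 * ((3 * k - r.1.1) * (r.1.1 ^ 2 + (1 - 2 * k ^ 2) * r.1.2 ^ 2)
    - 2 * k ^ 3)) (by fun_prop) (by ring)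
  have e3 := hsmall (fun r => 16 * k * s * (r.1.1 ^ 3 - k ^ 3)) (by fun_prop) (by ring)
  have e4 := hsmall (fun r => -8 * k * s ^ 2 * r.1.1 * (3 * k - r.1.1) *
    (1 + (r.2.1 ^ 2 + r.2.2 ^ 2)) + 8 * k * s ^ 2 * (r.1.1 ^ 2 + k ^ 2) *
    (1 - (r.2.1 ^ 2 + r.2.2 ^ 2))) (by fun_prop) (by ring)
  have e5 := hsmall (fun r => -8 * k ^ 2 * s * r.1.1 * (3 * k - r.1.1) *
    ((r.2.1 ^ 2 + r.2.2 ^ 2) - 1) + 8 * k ^ 2 * s * (s ^ 2 - r.1.1 ^ 2) *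
    (1 + (r.2.1 ^ 2 + r.2.2 ^ 2)) - 8 * k ^ 2 * s) (by fun_prop) (by rw [hs]; ring)
  filter_upwards [e1, e2, e3, e4, e5] with r h1 h2 h3 h4 h5 u w α β n hr hn hu hw
  subst hr
  rw [← hn] at h4 h5
  refine gap_le hk0 hs0 hs hn hu hw hε0 ?_ rfl rfl rfl rfl rfl h1 h2 h3 h4 h5
  have hq := quadratic_form_coercive hk0 hk1 hs0 w α β
  rw [← hn, ← hM] at hq
  rw [show 5 * (1 / (5 * M)) * (n + w ^ 2) = (n + w ^ 2) / M by field_simp, div_le_iff₀' hM0]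
  exact hq

lemma thetaCn_zero (k : ℝ) : thetaCn k 0 0 = 0 := by
  rw [thetaCn_eq, thetaIntegral]; simp

/-- Divide the gap estimate by `G₂`, which is positive and locally bounded by `G₂(0,0) + 1`. Keeping
the term `c(k - u)` is what later makes the second derivative strictly negative. -/
theorem exists_eventually_uCnRogue_le (hk0 : 0 < k) (hk1 : k < 1) :
    ∃ c : ℝ, 0 < c ∧ ∀ᶠ p : ℝ × ℝ in nhds (0, 0),
      uCnRogue k p.1 p.2 ≤ 3 * k - c * (k - uCn k p.1 p.2) := by
  have hs0 := sqrt_one_sub_sq_pos hk0 hk1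
  have hs := sq_sqrt_one_sub_sq hk0 hk1
  have hB : 0 < G₂ k 0 0 + 1 := by linarith [G₂_pos hk0 hk1 0 0]
  refine ⟨k ^ 2 * Real.sqrt (1 - k ^ 2) ^ 2 / (G₂ k 0 0 + 1), by positivity, ?_⟩
  have hc : Continuous (fun p : ℝ × ℝ => ((uCn k p.1 p.2, uCnX k p.1 p.2),
      ((thetaCn k p.1 p.2).re, (thetaCn k p.1 p.2).im))) :=
    ((contDiff_uCn hk0.le hk1).continuous.prodMk (contDiff_uCnX hk0.le hk1).continuous).prodMk
      ((Complex.continuous_re.comp (contDiff_thetaCn hk0 hk1).continuous).prodMk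
        (Complex.continuous_im.comp (contDiff_thetaCn hk0 hk1).continuous))
  have hlim := hc.tendsto ((0, 0) : ℝ × ℝ)
  simp only [uCn_zero hk0.le hk1, uCnX_zero hk0.le hk1, thetaCn_zero, Complex.zero_re,
    Complex.zero_im] at hlim
  have hG : ∀ᶠ p : ℝ × ℝ in nhds (0, 0), G₂ k p.1 p.2 < G₂ k 0 0 + 1 :=
    (contDiff_G₂ hk0 hk1).continuous.continuousAt.eventually_lt_const (by simp)
  filter_upwards [hlim.eventually (eventually_gap hk0 hk1 hs0 hs), hG] with p hp hGp
  have h1 := hp _ _ _ _ _ rfl rfl (abs_uCn_le hk0.le p.1 p.2) (uCnX_sq hk0.le hk1 p.1 p.2)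
  rw [← G₂_real hk0 hk1, ← G₁_real hk0 hk1] at h1
  have hpos := G₂_pos hk0 hk1 p.1 p.2
  have hδ : 0 ≤ k - uCn k p.1 p.2 := by linarith [(abs_le.mp (abs_uCn_le hk0.le p.1 p.2)).2]
  have h2 : k ^ 2 * Real.sqrt (1 - k ^ 2) ^ 2 / (G₂ k 0 0 + 1) * (k - uCn k p.1 p.2) ≤
      k ^ 2 * Real.sqrt (1 - k ^ 2) ^ 2 * (k - uCn k p.1 p.2) / G₂ k p.1 p.2 := by
    rw [div_mul_eq_mul_div]
    gcongr
  have h3 : k ^ 2 * Real.sqrt (1 - k ^ 2) ^ 2 * (k - uCn k p.1 p.2) / G₂ k p.1 p.2 ≤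
      3 * k - uCn k p.1 p.2 - G₁ k p.1 p.2 / G₂ k p.1 p.2 := by
    rw [div_le_iff₀ hpos, sub_mul, div_mul_cancel₀ _ hpos.ne']
    exact h1
  rw [uCnRogue]
  linarith

theorem uCnRogue_zero (hk0 : 0 < k) (hk1 : k < 1) : uCnRogue k 0 0 = 3 * k := by
  have hs0 := sqrt_one_sub_sq_pos hk0 hk1
  rw [uCnRogue, G₁_real hk0 hk1, G₂_real hk0 hk1, thetaCn_zero, uCn_zero hk0.le hk1]
  simp only [Complex.zero_re, Complex.zero_im]
  field_simp
  ring

theorem isLocalMax_uCnRogue (hk0 : 0 < k) (hk1 : k < 1) :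
    IsLocalMax (fun p : ℝ × ℝ => uCnRogue k p.1 p.2) (0, 0) := by
  obtain ⟨c, hc, h⟩ := exists_eventually_uCnRogue_le hk0 hk1
  filter_upwards [h] with p hp
  simp only [uCnRogue_zero hk0 hk1]
  have := mul_nonneg hc.le (sub_nonneg.mpr (abs_le.mp (abs_uCn_le hk0.le p.1 p.2)).2)
  linarith

/-- The second derivative is nonpositive at a local maximum. -/
lemma iteratedDeriv_two_nonpos_of_isLocalMax {f : ℝ → ℝ} {a : ℝ} (hf : ContinuousAt f a)
    (h : IsLocalMax f a) : iteratedDeriv 2 f a ≤ 0 := by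
  rw [iteratedDeriv_succ, iteratedDeriv_one]
  by_contra! hpos
  -- A positive second derivative would make the point a local minimum as well, so `f` would be
  -- locally constant.
  have hmin := isLocalMin_of_deriv_deriv_pos hpos h.deriv_eq_zero hf
  have hconst : f =ᶠ[nhds a] fun _ => f a := by
    filter_upwards [h, hmin] with x h1 h2 using le_antisymm h1 h2
  have h0 : deriv (deriv f) a = 0 := by
    rw [hconst.deriv.deriv_eq]
    simp
  exact hpos.ne' h0

/-- `u_rogue - c u` also has a local maximum at the origin, so `∂ₓ²u_rogue ≤ c u_xx = c((2k² - 1)k -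
2k³) = -ck < 0`. -/
theorem iteratedDeriv_two_uCnRogue_neg (hk0 : 0 < k) (hk1 : k < 1) :
    iteratedDeriv 2 (fun x => uCnRogue k x 0) 0 < 0 := by
  obtain ⟨c, hc, h⟩ := exists_eventually_uCnRogue_le hk0 hk1
  have hline : ContDiff ℝ ∞ (fun x : ℝ => ((x, 0) : ℝ × ℝ)) := contDiff_id.prodMk contDiff_const
  have hr := (contDiff_uCnRogue hk0 hk1).comp hline
  have hu := (contDiff_uCn hk0.le hk1).comp hline
  simp only [Function.comp_def] at hr hu
  have hr2 := contDiff_infty.mp hr 2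
  have hu2 := contDiff_infty.mp hu 2
  have hmax : IsLocalMax (fun x => uCnRogue k x 0 - c * uCn k x 0) 0 := by
    have h1 : ∀ᶠ x : ℝ in nhds 0, uCnRogue k x 0 ≤ 3 * k - c * (k - uCn k x 0) :=
      (hline.continuous.tendsto' 0 (0, 0) rfl).eventually h
    filter_upwards [h1] with x hx
    simp only [uCnRogue_zero hk0 hk1, uCn_zero hk0.le hk1]
    linarith
  have h2 : iteratedDeriv 2 (fun x => uCnRogue k x 0 - c * uCn k x 0) 0 ≤ 0 :=
    iteratedDeriv_two_nonpos_of_isLocalMax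
      (hr.continuous.sub (continuous_const.mul hu.continuous)).continuousAt hmax
  have h3 : iteratedDeriv 2 (fun x => uCnRogue k x 0 - c * uCn k x 0) 0 =
      iteratedDeriv 2 (fun x => uCnRogue k x 0) 0 -
        c * iteratedDeriv 2 (fun x => uCn k x 0) 0 := by
    rw [iteratedDeriv_fun_sub hr2.contDiffAt (contDiffAt_const.mul hu2.contDiffAt),
      iteratedDeriv_const_mul_field]
  rw [h3, iteratedDeriv_two_uCn hk0.le hk1, uCn_zero hk0.le hk1, cnSpeed] at h2
  have h4 := mul_pos hc hk0
  nlinarith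

theorem magnificationCn_eq (hk0 : 0 < k) (hk1 : k < 1) : magnificationCn k = 3 := by
  rw [magnificationCn, (isGreatest_cnAmplitudes hk0.le hk1).csSup_eq, uCnRogue_zero hk0 hk1]
  field_simp

end Maximum

end MKdV

end

/-! ### The main theorem. -/

theorem mainTheorem2 (k : ℝ) (hk0 : 0 < k) (hk1 : k < 1) :
    -- the background is a solution, and the eigenfunctions at `λ_I` exist
    MKdV.IsSolution (MKdV.uCn k) ∧
    (∃ φ₁ φ₂ : ℝ → ℝ → ℂ, MKdV.IsCnEigenfunction k φ₁ φ₂) ∧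
    -- the non-periodic eigenfunctions and the two-fold Darboux transformation
    (∀ φ₁ φ₂ : ℝ → ℝ → ℂ, MKdV.IsCnEigenfunction k φ₁ φ₂ →
      (∀ x t : ℝ, φ₁ x t ≠ 0 ∧ φ₂ x t ≠ 0) ∧
      (∃ L : ℝ, 0 < L ∧ ∀ t : ℝ,
        Function.Periodic (fun x => φ₁ x t) L ∧ Function.Periodic (fun x => φ₂ x t) L) ∧
      MKdV.IsLaxSolution (MKdV.lamI k) (MKdV.uCn k) (MKdV.psi₁ k φ₂) (MKdV.psi₂ k φ₁) ∧
      MKdV.IsLaxSolution (starRingEnd ℂ (MKdV.lamI k)) (MKdV.uCn k)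
        (fun x t => starRingEnd ℂ (MKdV.psi₁ k φ₂ x t))
        (fun x t => starRingEnd ℂ (MKdV.psi₂ k φ₁ x t)) ∧
      (∀ x t : ℝ, φ₁ x t * MKdV.psi₂ k φ₁ x t - φ₂ x t * MKdV.psi₁ k φ₂ x t = 2) ∧
      (∀ t L : ℝ, L ≠ 0 →
        ¬ Function.Periodic (fun x => MKdV.psi₁ k φ₂ x t) L ∧
        ¬ Function.Periodic (fun x => MKdV.psi₂ k φ₁ x t) L) ∧
      ∀ x t : ℝ,
        MKdV.twoFoldDenom (MKdV.lamI k) (starRingEnd ℂ (MKdV.lamI k))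
          (MKdV.psi₁ k φ₂ x t) (MKdV.psi₂ k φ₁ x t)
          (starRingEnd ℂ (MKdV.psi₁ k φ₂ x t)) (starRingEnd ℂ (MKdV.psi₂ k φ₁ x t)) ≠ 0 ∧
        MKdV.twoFoldDarboux (MKdV.uCn k x t : ℂ)
          (MKdV.lamI k) (starRingEnd ℂ (MKdV.lamI k))
          (MKdV.psi₁ k φ₂ x t) (MKdV.psi₂ k φ₁ x t)
          (starRingEnd ℂ (MKdV.psi₁ k φ₂ x t)) (starRingEnd ℂ (MKdV.psi₂ k φ₁ x t))
          = (MKdV.uCnRogue k x t : ℂ)) ∧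
    -- the explicit formula is non-degenerate and gives a solution of mKdV
    (∀ x t : ℝ, MKdV.G₂ k x t ≠ 0) ∧
    MKdV.IsSolution (MKdV.uCnRogue k) ∧
    -- it approaches `-u_cn` as `|x| + |t| → ∞`
    Filter.Tendsto (fun p : ℝ × ℝ => MKdV.uCnRogue k p.1 p.2 - (-MKdV.uCn k p.1 p.2))
      (Filter.comap (fun p : ℝ × ℝ => |p.1| + |p.2|) Filter.atTop) (nhds 0) ∧
    -- local maximum `3k` at the origin, and magnification factor `3`
    IsLocalMax (fun p : ℝ × ℝ => MKdV.uCnRogue k p.1 p.2) (0, 0) ∧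
    iteratedDeriv 2 (fun x => MKdV.uCnRogue k x 0) 0 < 0 ∧
    MKdV.uCnRogue k 0 0 = 3 * k ∧
    IsGreatest (MKdV.cnAmplitudes k) k ∧
    MKdV.magnificationCn k = 3 := by
  refine ⟨MKdV.isSolution_uCn hk0.le hk1, MKdV.exists_isCnEigenfunction hk0 hk1,
    fun φ₁ φ₂ hφ => ?_, fun x t => (MKdV.G₂_pos hk0 hk1 x t).ne',
    MKdV.isSolution_uCnRogue hk0 hk1, MKdV.tendsto_uCnRogue_add_uCn hk0 hk1,
    MKdV.isLocalMax_uCnRogue hk0 hk1, MKdV.iteratedDeriv_two_uCnRogue_neg hk0 hk1,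
    MKdV.uCnRogue_zero hk0 hk1, MKdV.isGreatest_cnAmplitudes hk0.le hk1,
    MKdV.magnificationCn_eq hk0 hk1⟩
  obtain ⟨hlax, hv⟩ := (MKdV.isCnEigenfunction_iff hk0 hk1).mp hφ
  have hpsi := MKdV.isCnLaxOn_psi hk0 hk1 hlax hv
  have hper := MKdV.periodic_eigenfunction hk0 hk1 hlax hv
  have hT := Jacobi.period_pos hk0.le hk1
  have hT2 : 0 < 2 * Jacobi.period k := by linarith
  refine ⟨fun x t => ⟨(hv x t).P_ne, (hv x t).Q_ne⟩, ⟨2 * Jacobi.period k, hT2, hper⟩,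
    (MKdV.isLaxSolution_uCn_iff hk0 hk1).mpr hpsi,
    (MKdV.isLaxSolution_uCn_iff hk0 hk1).mpr hpsi.conj, MKdV.wronskian_psi hv,
    fun t L hL => ⟨?_, ?_⟩, fun x t => ⟨MKdV.twoFoldDenom_psi_ne_zero hk0 hk1 (hv x t),
      MKdV.twoFoldDarboux_psi hk0 hk1 (hv x t)⟩⟩
  · refine MKdV.not_periodic_of_mul_eq_thetaCn hk0 hk1 (g := fun x => φ₂ x t) (t := t) (a := -1)
      hL hT2.ne' ?_ ?_ (hper t).2 fun x => ?_
    · exact continuous_iff_continuousAt.mpr fun x => (hpsi.px x t trivial).continuousAt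
    · exact continuous_iff_continuousAt.mpr fun x => (hlax.qx x t trivial).continuousAt
    · have := (hv x t).Q_ne
      simp only [MKdV.psi₁]
      field_simp
      push_cast
      ring
  · refine MKdV.not_periodic_of_mul_eq_thetaCn hk0 hk1 (g := fun x => φ₁ x t) (t := t) (a := 1)
      hL hT2.ne' ?_ ?_ (hper t).1 fun x => ?_
    · exact continuous_iff_continuousAt.mpr fun x => (hpsi.qx x t trivial).continuousAt
    · exact continuous_iff_continuousAt.mpr fun x => (hlax.px x t trivial).continuousAt
    · have := (hv x t).P_ne
      simp only [MKdV.psi₂]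
      field_simp
      push_cast
      ring
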